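/- Let $W=(W_t)_{t\ge 0}$ be a standard Brownian motion on a probability space, and let $I_2^W(g)$ denote the double Wiener--It\^o integral of a symmetric kernel $g\in L^2_s(\mathbb{R}_+^2)$. For $g \in L^2_s(\mathbb{R}_+^2)$ let $T_g$ be the self-adjoint Hilbert--Schmidt operator $T_g h=\int_0^\infty g(\cdot,y)h(y)\,dy$ on $L^2(\mathbb{R}_+)$, let $E(g)$ be the set of nonzero eigenvalues of $T_g$, let $\mathrm{rank}(g)$ be the rank of $T_g$, and let $a(g)=\#E(g)$. Write $\kappa_r(X)$ for the $r$-th cumulant of a random variable $X$. **Theorem.** Let $f\in L^2_s(\mathbb{R}_+^2)$ with $0\le \mathrm{rank}(f)<\infty$, let $\mu_0\in\mathbb{R}$ with $|\mu_0|+\|f\|_{L^2(\mathbb{R}_+^2)}>0$, and let $N\sim\mathcal{N}(0,\mu_0^2)$ be independent of the Brownian motion that defines $I_2^W(f)$ (the variable $N+I_2^W(f)$ may be realized, with its own Brownian motion, on another probability space, since only its law matters). Set $$Q(x)=x^{2(1+\mathbf{1}_{\{\mu_0\ne 0\}})}\prod_{\lambda\in E(f)}(x-\lambda)^2 .$$ Let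 $\{F_n\}_{n\ge 1}$ be a sequence of double Wiener--It\^o integrals with respect to $W$. Then $\kappa_2(N+I_2^W(f))=\mu_0^2+2\|f\|^2_{L^2(\mathbb{R}_+^2)}$ and, for each integer $s\ge 2(1+\mathbf{1}_{\{\mu_0\neq 0\}})$, as $n\to\infty$, (i) $F_n\to N+I_2^W(f)$ in law if and only if all of the following hold: (ii-a) $\kappa_2(F_n)\to\kappa_2(N+I_2^W(f))$; (ii-b) $\displaystyle\sum_{r=3}^{\deg Q}\frac{Q^{(r)}(0)}{r!}\,\frac{\kappa_r(F_n)}{(r-1)!\,2^{r-1}}\to\sum_{r=3}^{\deg Q}\frac{Q^{(r)}(0)}{r!}\,\frac{\kappa_r(I_2^W(f))}{(r-1)!\,2^{r-1}}$; (ii-c) $\kappa_r(F_n)\to\kappa_r(I_2^W(f))$ for the $a(f)$ consecutive values $r=s,s+1,\dots,s+a(f)-1$ (no condition if $a(f)=0$). In particular: (1) (Nualart--Peccati criterion) if $f=0$ and $\mu_0\neq0$, then $F_n\to\mathcal{N}(0,\mu_0^2)$ in law if and only if $\kappa_2(F_n)\to\mu_0^2$ and $\kappa_4(F_n)\to 0$;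 (2) (Nourdin--Peccati chi-square criterion) if $\mu_0=0$ and $E(f)=\{1\}$, then, with $\rho=\mathrm{rank}(f)$, $F_n\to I_2^W(f)$ in law if and only if $\kappa_2(F_n)\to 2\rho$ and $\kappa_4(F_n)-12\,\kappa_3(F_n)\to-48\rho$. -/

import Mathlib

open MeasureTheory ProbabilityTheory Filter Topology
open scoped NNReal ENNReal

noncomputable section

namespace SecondChaos

/-- Lebesgue measure on the half line `[0, ∞)`, as a measure on `ℝ`. -/
abbrev halfLine : Measure ℝ := volume.restrict (Set.Ici 0)

/-- The space `L²(ℝ₊)`. -/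
abbrev L2Half : Type := Lp ℝ 2 halfLine

/-- The space `L²(ℝ₊²)`. -/
abbrev L2Quadrant : Type := Lp ℝ 2 (halfLine.prod halfLine)

/-- `f(x, y) = f(y, x)` for almost every `(x, y)`. -/
def IsSymmetricKernel (f : L2Quadrant) : Prop :=
  ∀ᵐ p ∂(halfLine.prod halfLine), f p.swap = f p

/-! ### The integral operator of a square integrable kernel -/

/-- Almost every section of a square integrable kernel is square integrable. -/
lemma memLp_section (f : L2Quadrant) :
    ∀ᵐ x ∂halfLine, MemLp (fun y => f (x, y)) 2 halfLine := by
  have hf : MemLp f 2 (halfLine.prod halfLine) := Lp.memLp f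
  have h1 := hf.integrable_sq.prod_right_ae
  have h2 := hf.aestronglyMeasurable.prodMk_left
  filter_upwards [h1, h2] with x hx1 hx2
  exact (memLp_two_iff_integrable_sq hx2).2 hx1

/-- Cauchy-Schwarz inequality. -/
lemma sq_integral_mul_le {u v : ℝ → ℝ} (hu : MemLp u 2 halfLine) (hv : MemLp v 2 halfLine) :
    (∫ y, u y * v y ∂halfLine) ^ 2 ≤ (∫ y, u y ^ 2 ∂halfLine) * ∫ y, v y ^ 2 ∂halfLine := by
  have huv : Integrable (fun y => u y * v y) halfLine := hu.integrable_mul hv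
  have hquad : ∀ t : ℝ, 0 ≤ (∫ y, v y ^ 2 ∂halfLine) * (t * t)
      + (2 * ∫ y, u y * v y ∂halfLine) * t + ∫ y, u y ^ 2 ∂halfLine := by
    intro t
    have h : 0 ≤ ∫ y, (v y ^ 2 * (t * t) + (u y * v y) * (2 * t)) + u y ^ 2 ∂halfLine :=
      integral_nonneg fun y => by
        have : 0 ≤ (u y + t * v y) ^ 2 := sq_nonneg _
        simp only [Pi.zero_apply]
        nlinarith
    have i1 : Integrable (fun y => v y ^ 2 * (t * t)) halfLine := hv.integrable_sq.mul_const _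
    have i2 : Integrable (fun y => (u y * v y) * (2 * t)) halfLine := huv.mul_const _
    have i3 : Integrable (fun y => v y ^ 2 * (t * t) + (u y * v y) * (2 * t)) halfLine :=
      i1.add i2
    rw [integral_add i3 hu.integrable_sq, integral_add i1 i2, integral_mul_const,
      integral_mul_const] at h
    linarith
  have hd := discrim_le_zero hquad
  unfold discrim at hd
  nlinarith

/-- If `f ∈ L²(ℝ₊²)` and `g ∈ L²(ℝ₊)`, then `x ↦ ∫ f(x, y) g(y) dy` belongs to `L²(ℝ₊)`. -/
lemma memLp_integral (f : L2Quadrant) (g : L2Half) :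
    MemLp (fun x => ∫ y, f (x, y) * g y ∂halfLine) 2 halfLine := by
  have hf : MemLp f 2 (halfLine.prod halfLine) := Lp.memLp f
  have hg : MemLp g 2 halfLine := Lp.memLp g
  have hm : AEStronglyMeasurable (fun x => ∫ y, f (x, y) * g y ∂halfLine) halfLine :=
    (hf.aestronglyMeasurable.mul hg.aestronglyMeasurable.comp_snd).integral_prod_right'
  refine (memLp_two_iff_integrable_sq hm).2 ?_
  refine (hf.integrable_sq.integral_prod_left.mul_const (∫ y, g y ^ 2 ∂halfLine)).mono'
    (hm.pow 2) ?_
  filter_upwards [memLp_section f] with x hx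
  rw [Real.norm_eq_abs, abs_of_nonneg (sq_nonneg _)]
  exact sq_integral_mul_le hx hg

/-- The Hilbert-Schmidt operator `T_f : L²(ℝ₊) → L²(ℝ₊)`, `g ↦ ∫ f(·, y) g(y) dy`. -/
def kernelOperator (f : L2Quadrant) : Module.End ℝ L2Half where
  toFun g := (memLp_integral f g).toLp
  map_add' g h := by
    rw [← MemLp.toLp_add, MemLp.toLp_eq_toLp_iff]
    filter_upwards [memLp_section f] with x hx
    have h1 : Integrable (fun y => f (x, y) * g y) halfLine := hx.integrable_mul (Lp.memLp g)
    have h2 : Integrable (fun y => f (x, y) * h y) halfLine := hx.integrable_mul (Lp.memLp h)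
    rw [Pi.add_apply, ← integral_add h1 h2]
    refine integral_congr_ae ?_
    filter_upwards [Lp.coeFn_add g h] with y hy
    rw [hy, Pi.add_apply, mul_add]
  map_smul' c g := by
    rw [RingHom.id_apply, ← MemLp.toLp_const_smul, MemLp.toLp_eq_toLp_iff]
    refine Eventually.of_forall fun x => ?_
    rw [Pi.smul_apply, smul_eq_mul, ← integral_const_mul]
    refine integral_congr_ae ?_
    filter_upwards [Lp.coeFn_smul c g] with y hy
    rw [hy, Pi.smul_apply, smul_eq_mul]
    ring

/-- `f` has finite rank: the range of `T_f` is finite-dimensional. -/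
def HasFiniteRank (f : L2Quadrant) : Prop :=
  FiniteDimensional ℝ (LinearMap.range (kernelOperator f))

/-- The rank of `f`, i.e. the dimension of the range of `T_f` (used for `f` of finite rank). -/
def rank (f : L2Quadrant) : ℕ :=
  Module.finrank ℝ (LinearMap.range (kernelOperator f))

/-- The set `E(f)` of the nonzero eigenvalues of `T_f`. -/
def nonzeroEigenvalues (f : L2Quadrant) : Set ℝ :=
  {l | l ≠ 0 ∧ (kernelOperator f).HasEigenvalue l}

/-- `a(f)`, the number of distinct nonzero eigenvalues of `T_f` (used for `f` of finite rank). -/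
def numEigenvalues (f : L2Quadrant) : ℕ := (nonzeroEigenvalues f).ncard

open Classical in
/-- `1 + 𝟙_{μ₀ ≠ 0}`. -/
def multiplicityAtZero (μ₀ : ℝ) : ℕ := 1 + if μ₀ ≠ 0 then 1 else 0

open Polynomial in
/-- `Q(x) = x ^ (2 (1 + 𝟙_{μ₀ ≠ 0})) ∏ (x - λ)²`, the product being over the distinct nonzero
eigenvalues `λ` of `T_f` (a finite set when `f` has finite rank). -/
def testPolynomial (μ₀ : ℝ) (f : L2Quadrant) : ℝ[X] :=
  X ^ (2 * multiplicityAtZero μ₀) * ∏ᶠ l ∈ nonzeroEigenvalues f, (X - C l) ^ 2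

/-- The Taylor coefficient `Q⁽ʳ⁾(0) / r!` of a polynomial. -/
def taylorCoeff (Q : Polynomial ℝ) (r : ℕ) : ℝ :=
  (Polynomial.derivative^[r] Q).eval 0 / (r.factorial : ℝ)

/-! ### Double Wiener-Itô integrals -/

/-- A symmetric step kernel vanishing on the diagonal:
`∑ i, ∑ j, a i j 𝟙_{(t i, t (i+1)]}(x) 𝟙_{(t j, t (j+1)]}(y)`, where `0 ≤ t 0 ≤ ⋯ ≤ t m` and `a` is a
symmetric matrix with zero diagonal. -/
structure StepKernel where
  size : ℕ
  time : Fin (size + 1) → ℝ≥0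
  time_mono : Monotone time
  coeff : Matrix (Fin size) (Fin size) ℝ
  coeff_symm : coeff.IsSymm
  coeff_diag : ∀ i, coeff i i = 0

/-- The step kernel as a function on `ℝ²`. -/
def StepKernel.toFun (g : StepKernel) (p : ℝ × ℝ) : ℝ :=
  ∑ i, ∑ j, g.coeff i j
    * (Set.Ioc (g.time i.castSucc : ℝ) (g.time i.succ)).indicator 1 p.1
    * (Set.Ioc (g.time j.castSucc : ℝ) (g.time j.succ)).indicator 1 p.2

/-- The double integral of a step kernel:
`∑ i, ∑ j, a i j (W (t (i+1)) - W (t i)) (W (t (j+1)) - W (t j))`. -/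
def StepKernel.integral {Ω : Type*} (g : StepKernel) (W : ℝ≥0 → Ω → ℝ) (ω : Ω) : ℝ :=
  ∑ i, ∑ j, g.coeff i j
    * (W (g.time i.succ) ω - W (g.time i.castSucc) ω)
    * (W (g.time j.succ) ω - W (g.time j.castSucc) ω)

/-- `F = I₂^W(f)` almost surely. The double Wiener-Itô integral is the continuous extension, from
`L²(ℝ₊²)` to `L²(P)`, of the double integral of step kernels vanishing on the diagonal; its graph is
the closure of the graph of the latter. -/
def IsDoubleIntegral {Ω : Type*} [MeasurableSpace Ω] (W : ℝ≥0 → Ω → ℝ) (P : Measure Ω)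
    (f : L2Quadrant) (F : Ω → ℝ) : Prop :=
  MemLp F 2 P ∧ ∃ g : ℕ → StepKernel,
    Tendsto (fun n => eLpNorm (fun p => (g n).toFun p - f p) 2 (halfLine.prod halfLine))
      atTop (𝓝 0) ∧
    Tendsto (fun n => eLpNorm (fun ω => (g n).integral W ω - F ω) 2 P) atTop (𝓝 0)

/-- The `r`-th cumulant of `X`: the `r`-th derivative at `0` of the cumulant generating function
`t ↦ log E[exp (t X)]` (for `X` with exponential moments of small order, such as the sum of a
Gaussian variable and an independent double Wiener-Itô integral). -/
def cumulant {Ω : Type*} [MeasurableSpace Ω] (r : ℕ) (X : Ω → ℝ) (P : Measure Ω) : ℝ :=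
  iteratedDeriv r (cgf X P) 0

end SecondChaos

end

/-!
The diagonalization of the matrix of a step kernel, together with the rotation invariance of the
standard Gaussian law, shows that the double integral of the kernel has the law `chaosLaw l` of
`∑ i, l i (Y i ^ 2 - 1)`, where the `Y i` are independent standard Gaussian variables and `l` is the
family of eigenvalues (`StepKernel.map_integral`). This law has the characteristic function
`exp (∑ i, squareCgf (i t l i))`, and its cumulants of order `r ≥ 2` are
`2 ^ (r - 1) (r - 1)! ∑ i, l i ^ r`. A double Wiener-Itô integral is a limit in `L²` of double
integrals of step kernels. Consequently a sequence of double integrals may be replaced by a sequence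
of laws `chaosLaw (l n)` without changing the asymptotics of characteristic functions and cumulants
(`exists_chaosLaw_seq`), and both sides of the equivalence become statements on the power sums of
the weights `l n`.

Traces of powers of Hilbert-Schmidt operators, of order at least `2`, are continuous in the kernel
(`abs_trace_pow_sub_trace_pow_le_of_isTensorSum`). Hence the power sums of the eigenvalues of step
kernels that approximate `f` tend to those of the nonzero eigenvalues `L j` of `T_f`, counted with
multiplicity (`tendsto_powerSum_eigenvalues`), and the law of `I₂(f)` is `chaosLaw L`. The limit
`N + I₂(f)` has the characteristic function `exp (∑ j, squareCgf (i t L j) - t² v)` with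
`v = μ₀² / 2`: the Gaussian part contributes `v` to the power sum of order `2` and nothing to the
others.

Convergence in law implies convergence of all cumulants. The modulus of the characteristic function
bounds `∑ i, l n i ^ 2` (`exists_powerSum_two_le`), so the Taylor series of its logarithm have a
common disc of convergence; their coefficients form a relatively compact sequence, and the limit
points are the cumulants of the limit by the identity theorem
(`tendsto_cumulant_of_tendsto_charFun`).

Conversely, consider the measures `∑ i, l n i ^ 2 δ_{l n i}`, whose moments are the power sums. The
conditions on the second cumulant and on `Q` say that the masses are bounded and that the integrals
of `Q / x ^ 2 = R ^ 2` tend to `0`, where `R = x ^ d ∏ (x - λ)` and `d` is `0` if `μ₀ = 0` and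
`1` otherwise. By the Cauchy-Schwarz inequality, the integrals of all multiples of
`R` tend to `0`. By Lagrange interpolation, every polynomial is modulo `R` a combination of the
monomials whose integrals converge by hypothesis, so that all power sums converge
(`tendsto_powerSum_of_tendsto_testPolynomial`). By the Weierstrass approximation theorem the
measures then converge weakly, and so do the laws, since the logarithm of the characteristic
function is the integral of the continuous function `squareCgf (i t x) / x ^ 2`
(`tendsto_charFun_chaosLaw`).
-/

noncomputable section

namespace SecondChaos

/-! ### Weighted sums of centred squares of independent Gaussian variables -/

/-- The cumulant generating function `z ↦ log E[exp (z (Y² - 1))] = -log (1 - 2 z) / 2 - z`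
of `Y² - 1`, where `Y` is a standard Gaussian variable. -/
def squareCgf (z : ℂ) : ℂ := -Complex.log (1 - 2 * z) / 2 - z

/-- The law of `∑ i, l i (Y i ^ 2 - 1)` for independent standard Gaussian variables `Y i`. -/
def chaosLaw {ι : Type*} [Fintype ι] (l : ι → ℝ) : Measure ℝ :=
  (Measure.pi fun _ : ι => gaussianReal 0 1).map fun x => ∑ i, l i * (x i ^ 2 - 1)

/-- The power sum `∑ i, l i ^ r`. -/
def powerSum {ι : Type*} [Fintype ι] (l : ι → ℝ) (r : ℕ) : ℝ := ∑ i, l i ^ r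

lemma one_add_sum_le_prod_one_add {ι : Type*} (s : Finset ι) {a : ι → ℝ} (ha : ∀ i, 0 ≤ a i) :
    1 + ∑ i ∈ s, a i ≤ ∏ i ∈ s, (1 + a i) := by
  classical
  induction s using Finset.induction_on with
  | empty => simp
  | insert i s hi ih =>
    rw [Finset.sum_insert hi, Finset.prod_insert hi]
    have := Finset.sum_nonneg fun j (_ : j ∈ s) => ha j
    nlinarith [ha i, mul_nonneg (ha i) this, mul_le_mul_of_nonneg_left ih (ha i)]

section Gaussian

lemma gaussianPDFReal_smul_cexp (z : ℂ) (x : ℝ) :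
    gaussianPDFReal 0 1 x • Complex.exp (z * ((x : ℂ) ^ 2 - 1)) =
      (((√(2 * Real.pi))⁻¹ : ℝ) * Complex.exp (-z)) *
        Complex.exp (-(1 / 2 - z) * (x : ℂ) ^ 2) := by
  rw [gaussianPDFReal, Complex.real_smul]
  push_cast
  simp only [mul_one, sub_zero]
  rw [mul_assoc, mul_assoc _ (Complex.exp (-z)), ← Complex.exp_add, ← Complex.exp_add]
  congr 2
  ring

lemma integrable_cexp_mul_sq_sub_one {z : ℂ} (hz : z.re < 1 / 2) :
    Integrable (fun x : ℝ => Complex.exp (z * ((x : ℂ) ^ 2 - 1))) (gaussianReal 0 1) := by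
  rw [gaussianReal_of_var_ne_zero _ one_ne_zero,
    integrable_withDensity_iff_integrable_smul₀' (by fun_prop) (by simp [gaussianPDF])]
  simp_rw [toReal_gaussianPDF, gaussianPDFReal_smul_cexp]
  exact (integrable_cexp_neg_mul_sq (by simp; linarith)).const_mul _

lemma integral_cexp_mul_sq_sub_one {z : ℂ} (hz : z.re < 1 / 2) :
    ∫ x : ℝ, Complex.exp (z * ((x : ℂ) ^ 2 - 1)) ∂(gaussianReal 0 1)
      = Complex.exp (squareCgf z) := by
  rw [integral_gaussianReal_eq_integral_smul one_ne_zero]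
  simp_rw [gaussianPDFReal_smul_cexp]
  have hre : 0 < (1 - 2 * z).re := by simp; linarith
  have hne : 1 - 2 * z ≠ 0 := fun h => by simp [h] at hre
  rw [integral_const_mul, integral_gaussian_complex (by simp; linarith)]
  have h2 : (1 / 2 - z) ≠ 0 := fun h => hne (by linear_combination 2 * h)
  have hpi : (0 : ℝ) < 2 * Real.pi := by positivity
  have h1 : (Real.pi : ℂ) / (1 / 2 - z) = ((2 * Real.pi : ℝ) : ℂ) * (1 - 2 * z)⁻¹ := by
    push_cast; field_simp
  have harg : (1 - 2 * z).arg ≠ Real.pi := by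
    intro h
    rw [Complex.arg_eq_pi_iff] at h
    linarith [h.1]
  rw [h1, Complex.cpow_def_of_ne_zero (by simp [hne]),
    Complex.log_ofReal_mul hpi (inv_ne_zero hne), Complex.log_inv _ harg, squareCgf]
  have h3 : (((√(2 * Real.pi))⁻¹ : ℝ) : ℂ) = Complex.exp (-(Real.log (2 * Real.pi) : ℝ) / 2) := by
    rw [← Complex.ofReal_neg, ← Complex.ofReal_ofNat, ← Complex.ofReal_div, ← Complex.ofReal_exp]
    congr 1
    rw [Real.exp_half, Real.exp_neg, Real.exp_log hpi, Real.sqrt_inv]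
  rw [h3, ← Complex.exp_add, ← Complex.exp_add]
  congr 1
  ring

variable {ι : Type*} [Fintype ι]

lemma measurable_weightedSum (l : ι → ℝ) :
    Measurable fun x : ι → ℝ => ∑ i, l i * (x i ^ 2 - 1) :=
  Finset.measurable_sum _ fun i _ => by fun_prop

instance (l : ι → ℝ) : IsProbabilityMeasure (chaosLaw l) :=
  Measure.isProbabilityMeasure_map (measurable_weightedSum l).aemeasurable

lemma cexp_mul_sum_eq_prod (l : ι → ℝ) (z : ℂ) (x : ι → ℝ) :
    Complex.exp (z * ((∑ i, l i * (x i ^ 2 - 1) : ℝ) : ℂ))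
      = ∏ i, Complex.exp (z * l i * ((x i : ℂ) ^ 2 - 1)) := by
  rw [← Complex.exp_sum]
  push_cast
  rw [Finset.mul_sum]
  simp_rw [mul_assoc]

lemma integrable_cexp_chaosLaw (l : ι → ℝ) {z : ℂ} (hz : ∀ i, (z * l i).re < 1 / 2) :
    Integrable (fun x : ℝ => Complex.exp (z * x)) (chaosLaw l) := by
  rw [chaosLaw, integrable_map_measure (by fun_prop) (measurable_weightedSum l).aemeasurable]
  simp_rw [Function.comp_def, cexp_mul_sum_eq_prod]
  exact Integrable.fintype_prod (f := fun i (y : ℝ) => Complex.exp (z * l i * ((y : ℂ) ^ 2 - 1)))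
    fun i => integrable_cexp_mul_sq_sub_one (hz i)

lemma integral_cexp_chaosLaw (l : ι → ℝ) {z : ℂ} (hz : ∀ i, (z * l i).re < 1 / 2) :
    ∫ x : ℝ, Complex.exp (z * x) ∂(chaosLaw l) = Complex.exp (∑ i, squareCgf (z * l i)) := by
  rw [chaosLaw, integral_map (measurable_weightedSum l).aemeasurable (by fun_prop)]
  simp_rw [cexp_mul_sum_eq_prod]
  rw [integral_fintype_prod_eq_prod
    (f := fun i (y : ℝ) => Complex.exp (z * l i * ((y : ℂ) ^ 2 - 1))), Complex.exp_sum]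
  exact Finset.prod_congr rfl fun i _ => integral_cexp_mul_sq_sub_one (hz i)

lemma charFun_chaosLaw (l : ι → ℝ) (t : ℝ) :
    charFun (chaosLaw l) t = Complex.exp (∑ i, squareCgf (t * Complex.I * l i)) := by
  rw [charFun_apply_real, ← integral_cexp_chaosLaw]
  · congr with x; ring_nf
  · intro i; simp

/-- `|φ(t)|⁴ ≤ 1 / (1 + 4 t² ∑ l i ^ 2)` for the characteristic function `φ` of `chaosLaw l`:
`|φ(t)|⁻⁴` is the product of the `1 + 4 t² l i ^ 2`. -/
lemma norm_charFun_chaosLaw_pow_mul_le (l : ι → ℝ) (t : ℝ) :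
    ‖charFun (chaosLaw l) t‖ ^ 4 * (1 + 4 * t ^ 2 * powerSum l 2) ≤ 1 := by
  have h1 : ∀ i, ‖Complex.exp (squareCgf (t * Complex.I * l i))‖ ^ 4 * (1 + 4 * t ^ 2 * l i ^ 2)
      = 1 := by
    intro i
    set w : ℂ := 1 - 2 * (t * Complex.I * l i) with hw
    have hn : ‖w‖ ^ 2 = 1 + 4 * t ^ 2 * l i ^ 2 := by
      rw [← Complex.normSq_eq_norm_sq, Complex.normSq_apply]
      simp [hw]; ring
    have hpos : 0 < ‖w‖ := by
      rw [norm_pos_iff]; rintro h; rw [h] at hn; simp at hn; nlinarith [sq_nonneg (t * l i)]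
    rw [Complex.norm_exp, ← Real.exp_nat_mul, ← hn, squareCgf, ← hw]
    have : ((4 : ℕ) : ℝ) * (-Complex.log w / 2 - t * Complex.I * l i).re = -(2 * Real.log ‖w‖) := by
      have e : (-Complex.log w / 2 - t * Complex.I * l i) = ((-(1 / 2) : ℝ) : ℂ) * Complex.log w
        - ((t * l i : ℝ) : ℂ) * Complex.I := by push_cast; ring
      rw [e, Complex.sub_re, Complex.re_ofReal_mul, Complex.re_ofReal_mul, Complex.log_re]
      simp; ring
    rw [this, Real.exp_neg, two_mul, Real.exp_add, Real.exp_log hpos]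
    field_simp
  have h2 : 1 + 4 * t ^ 2 * powerSum l 2 ≤ ∏ i, (1 + 4 * t ^ 2 * l i ^ 2) := by
    rw [powerSum, Finset.mul_sum]
    exact one_add_sum_le_prod_one_add _ fun i => by positivity
  calc _ ≤ ‖charFun (chaosLaw l) t‖ ^ 4 * ∏ i, (1 + 4 * t ^ 2 * l i ^ 2) := by gcongr
    _ = 1 := by
      rw [charFun_chaosLaw, Complex.exp_sum, norm_prod, ← Finset.prod_pow, ← Finset.prod_mul_distrib]
      exact Finset.prod_eq_one fun i _ => h1 i

end Gaussian

/-! ### Cumulants from the Taylor series of the logarithm of the characteristic function -/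

lemma hasFPowerSeriesAt_tsum {𝕜 : Type*} [RCLike 𝕜] {a : ℕ → ℝ} {B : ℝ≥0}
    (ha : ∀ n, |a n| ≤ B ^ n) :
    HasFPowerSeriesAt (fun z : 𝕜 => ∑' n, (a n : 𝕜) * z ^ n)
      (FormalMultilinearSeries.ofScalars 𝕜 fun n => (a n : 𝕜)) 0 := by
  set p := FormalMultilinearSeries.ofScalars 𝕜 fun n => (a n : 𝕜)
  have hr : 0 < p.radius := by
    refine lt_of_lt_of_le ?_ (p.le_radius_of_bound (r := (B + 1)⁻¹) 1 fun n => ?_)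
    · simp
    · have h1 : ‖p n‖ ≤ B ^ n := by
        rw [FormalMultilinearSeries.ofScalars_norm]
        simpa using ha n
      have h2 : ((B : ℝ) * ((B : ℝ) + 1)⁻¹) ^ n ≤ 1 := by
        refine pow_le_one₀ (by positivity) ?_
        rw [← div_eq_mul_inv, div_le_one (by positivity)]; linarith
      calc ‖p n‖ * ((B + 1)⁻¹ : ℝ≥0) ^ n ≤ B ^ n * ((B + 1)⁻¹ : ℝ≥0) ^ n := by gcongr
        _ ≤ 1 := by rw [← mul_pow]; simpa using h2
  refine (p.hasFPowerSeriesOnBall hr).hasFPowerSeriesAt.congr (.of_forall fun z => ?_)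
  simp [p, FormalMultilinearSeries.sum, mul_comm]

/-- If the characteristic function of `μ` is `t ↦ exp (∑ a n (i t) ^ n)` near `0`, and if `μ` has
exponential moments of small order, then the cumulants of `μ` are the `n! a n`. The identity
theorem, applied to the complex moment generating function, carries the formula from the imaginary
to the real axis. -/
theorem iteratedDeriv_cgf_of_charFun {μ : Measure ℝ} [IsProbabilityMeasure μ]
    (hμ : 0 ∈ interior (integrableExpSet id μ)) {a : ℕ → ℝ} {B : ℝ≥0} (ha : ∀ n, |a n| ≤ B ^ n)
    (h : ∀ᶠ t : ℝ in 𝓝 0,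
      charFun μ t = Complex.exp (∑' n, (a n : ℂ) * (t * Complex.I) ^ n)) (n : ℕ) :
    iteratedDeriv n (cgf id μ) 0 = n.factorial * a n := by
  have hA : AnalyticAt ℂ (complexMGF id μ) 0 := analyticAt_complexMGF (by simpa using hμ)
  have hS : AnalyticAt ℂ (fun z : ℂ => Complex.exp (∑' n, (a n : ℂ) * z ^ n)) 0 :=
    (hasFPowerSeriesAt_tsum (𝕜 := ℂ) ha).analyticAt.cexp
  have hfreq : ∃ᶠ z : ℂ in 𝓝[≠] 0,
      complexMGF id μ z = Complex.exp (∑' n, (a n : ℂ) * z ^ n) := by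
    have ht : Tendsto (fun t : ℝ => (t : ℂ) * Complex.I) (𝓝[≠] 0) (𝓝[≠] 0) := by
      refine tendsto_nhdsWithin_of_tendsto_nhds_of_eventually_within _ ?_ ?_
      · refine Tendsto.mono_left ?_ nhdsWithin_le_nhds
        have : Continuous fun t : ℝ => (t : ℂ) * Complex.I := by fun_prop
        simpa using this.tendsto 0
      · filter_upwards [self_mem_nhdsWithin] with t ht
        simpa using ht
    refine ht.frequently (Eventually.frequently ?_)
    filter_upwards [h.filter_mono nhdsWithin_le_nhds] with t ht
    rw [complexMGF_id_mul_I, ht]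
  have heq := (hA.frequently_eq_iff_eventually_eq hS).1 hfreq
  have hreal : ∀ᶠ t : ℝ in 𝓝 0, ∑' n, (a n : ℝ) * t ^ n = cgf id μ t := by
    have hc : Tendsto (fun t : ℝ => (t : ℂ)) (𝓝 0) (𝓝 0) := by
      simpa using Complex.continuous_ofReal.tendsto 0
    filter_upwards [hc.eventually heq] with t ht
    rw [complexMGF_ofReal] at ht
    have h1 : ∑' n, (a n : ℂ) * (t : ℂ) ^ n = ((∑' n, a n * t ^ n : ℝ) : ℂ) := by
      rw [Complex.ofReal_tsum]; simp
    rw [h1, ← Complex.ofReal_exp, Complex.ofReal_inj] at ht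
    rw [cgf, ht, Real.log_exp]
  have hP : HasFPowerSeriesAt (cgf id μ) (FormalMultilinearSeries.ofScalars ℝ a) 0 :=
    HasFPowerSeriesAt.congr (by simpa using hasFPowerSeriesAt_tsum (𝕜 := ℝ) ha) hreal
  have := hP.eq_formalMultilinearSeries hP.analyticAt.hasFPowerSeriesAt
  have h2 := congrArg (fun p : FormalMultilinearSeries ℝ ℝ ℝ => p.coeff n) this
  simp only [FormalMultilinearSeries.coeff_ofScalars] at h2
  rw [h2]
  field_simp

/-- The Taylor coefficients at `0` of the cumulant generating function of `chaosLaw l`. -/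
def chaosCoeff {ι : Type*} [Fintype ι] (l : ι → ℝ) (n : ℕ) : ℝ :=
  if n < 2 then 0 else 2 ^ (n - 1) * powerSum l n / n

section

variable {ι : Type*} [Fintype ι]

lemma powerSum_two_nonneg (l : ι → ℝ) : 0 ≤ powerSum l 2 :=
  Finset.sum_nonneg fun _ _ => sq_nonneg _

lemma abs_le_of_powerSum_two_le {l : ι → ℝ} {M : ℝ} (hM : 0 ≤ M) (h : powerSum l 2 ≤ M ^ 2)
    (i : ι) : |l i| ≤ M :=
  abs_le_of_sq_le_sq ((Finset.single_le_sum (f := fun i => l i ^ 2)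
    (fun _ _ => sq_nonneg _) (Finset.mem_univ i)).trans h) hM

lemma abs_powerSum_le {l : ι → ℝ} {M : ℝ} (hM : 0 ≤ M) (h : powerSum l 2 ≤ M ^ 2)
    {r : ℕ} (hr : 2 ≤ r) : |powerSum l r| ≤ M ^ r := by
  obtain ⟨k, rfl⟩ := Nat.exists_eq_add_of_le hr
  calc |powerSum l (2 + k)| ≤ ∑ i, |l i ^ (2 + k)| := Finset.abs_sum_le_sum_abs _ _
    _ ≤ ∑ i, l i ^ 2 * M ^ k := by
      refine Finset.sum_le_sum fun i _ => ?_
      rw [pow_add, abs_mul, abs_of_nonneg (sq_nonneg _), abs_pow]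
      gcongr
      exact abs_le_of_powerSum_two_le hM h i
    _ = powerSum l 2 * M ^ k := by rw [powerSum, Finset.sum_mul]
    _ ≤ M ^ (2 + k) := by rw [pow_add]; gcongr

lemma abs_chaosCoeff_le {l : ι → ℝ} {M : ℝ} (hM : 0 ≤ M) (h : powerSum l 2 ≤ M ^ 2) (n : ℕ) :
    |chaosCoeff l n| ≤ (2 * M) ^ n := by
  unfold chaosCoeff
  split_ifs with hn
  · simp; positivity
  · have hn' : 2 ≤ n := not_lt.1 hn
    have h1 : (1 : ℝ) ≤ n := by exact_mod_cast (by omega : 1 ≤ n)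
    rw [abs_div, abs_mul, abs_of_nonneg (by positivity : (0 : ℝ) ≤ 2 ^ (n - 1)), Nat.abs_cast,
      mul_pow]
    refine (div_le_self (by positivity) h1).trans ?_
    gcongr
    · norm_num
    · omega
    · exact abs_powerSum_le hM h hn'

lemma hasSum_squareCgf {w : ℂ} (hw : ‖2 * w‖ < 1) :
    HasSum (fun n : ℕ => if n < 2 then 0 else 2 ^ (n - 1) * w ^ n / n) (squareCgf w) := by
  have h1 := ((Complex.hasSum_taylorSeries_neg_log hw).div_const 2).sub (hasSum_ite_eq 1 w)
  refine (funext fun n => ?_ : (fun n : ℕ => if n < 2 then (0 : ℂ) else 2 ^ (n - 1) * w ^ n / n) =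
    fun n : ℕ => (2 * w) ^ n / n / 2 - if n = 1 then w else 0) ▸ h1
  rcases n with _ | _ | n
  · simp
  · simp
  · have : (2 : ℂ) ^ (n + 1 + 1) = 2 ^ (n + 1) * 2 := pow_succ _ _
    simp [mul_pow, this]
    ring

lemma hasSum_chaosCoeff {l : ι → ℝ} {M : ℝ} (hM : 0 ≤ M) (h : powerSum l 2 ≤ M ^ 2) {z : ℂ}
    (hz : 2 * M * ‖z‖ < 1) :
    HasSum (fun n => (chaosCoeff l n : ℂ) * z ^ n) (∑ i, squareCgf (z * l i)) := by
  have h1 := hasSum_sum (s := Finset.univ) fun i (_ : i ∈ Finset.univ) =>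
    hasSum_squareCgf (w := z * l i) (by
      have := abs_le_of_powerSum_two_le hM h i
      simp only [norm_mul, Complex.norm_ofNat, Complex.norm_real, Real.norm_eq_abs]
      nlinarith [norm_nonneg z, mul_le_mul_of_nonneg_left this (norm_nonneg z)])
  convert h1 using 2 with n
  unfold chaosCoeff powerSum
  split_ifs
  · simp
  · push_cast
    rw [Finset.mul_sum, Finset.sum_div, Finset.sum_mul]
    exact Finset.sum_congr rfl fun i _ => by ring

end

/-! ### Weak limits of laws of weighted sums -/

/-- The weights of weakly convergent `chaosLaw`s are bounded in `ℓ²`. -/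
lemma exists_powerSum_two_le {m : ℕ → ℕ} {l : ∀ n, Fin (m n) → ℝ} {μ : Measure ℝ}
    [IsProbabilityMeasure μ]
    (h : ∀ t, Tendsto (fun n => charFun (chaosLaw (l n)) t) atTop (𝓝 (charFun μ t))) :
    ∃ M : ℝ, 0 < M ∧ ∀ n, powerSum (l n) 2 ≤ M ^ 2 := by
  -- a point `t ≠ 0` at which the limit does not vanish
  obtain ⟨t, ht, ht0⟩ : ∃ t : ℝ, charFun μ t ≠ 0 ∧ t ≠ 0 := by
    have hc : ∀ᶠ t : ℝ in 𝓝 0, charFun μ t ≠ 0 :=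
      (continuous_charFun (μ := μ)).continuousAt.eventually_ne (by simp)
    exact ((hc.filter_mono nhdsWithin_le_nhds).and self_mem_nhdsWithin :
      ∀ᶠ t : ℝ in 𝓝[≠] 0, charFun μ t ≠ 0 ∧ t ∈ ({0}ᶜ : Set ℝ)).exists
  have hlim : Tendsto (fun n => (‖charFun (chaosLaw (l n)) t‖ ^ 4)⁻¹) atTop
      (𝓝 (‖charFun μ t‖ ^ 4)⁻¹) := ((h t).norm.pow 4).inv₀ (by simpa using ht)
  obtain ⟨C, hC⟩ := hlim.bddAbove_range
  have hCn : ∀ n, (‖charFun (chaosLaw (l n)) t‖ ^ 4)⁻¹ ≤ C := fun n => hC ⟨n, rfl⟩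
  have hC0 : 0 ≤ C := le_trans (by positivity) (hCn 0)
  refine ⟨√(C / (4 * t ^ 2) + 1), by positivity, fun n => ?_⟩
  rw [Real.sq_sqrt (by positivity)]
  have hpos : 0 < ‖charFun (chaosLaw (l n)) t‖ ^ 4 := by
    have : charFun (chaosLaw (l n)) t ≠ 0 := by rw [charFun_chaosLaw]; exact Complex.exp_ne_zero _
    positivity
  have h1 : 1 + 4 * t ^ 2 * powerSum (l n) 2 ≤ C := by
    refine le_trans ?_ (hCn n)
    rw [← one_div, le_div_iff₀ hpos, mul_comm]
    exact norm_charFun_chaosLaw_pow_mul_le _ _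
  have h2 : powerSum (l n) 2 ≤ C / (4 * t ^ 2) := by
    rw [le_div_iff₀ (by positivity)]; linarith
  linarith

lemma integral_exp_mul_chaosLaw_le {ι : Type*} [Fintype ι] {l : ι → ℝ} {M : ℝ} (hM : 0 < M)
    (h : powerSum l 2 ≤ M ^ 2) {t : ℝ} (ht : |t| ≤ 1 / (4 * M)) :
    Integrable (fun x => Real.exp (t * x)) (chaosLaw l) ∧
      ∫ x, Real.exp (t * x) ∂(chaosLaw l) ≤ Real.exp 2 := by
  have ht' : |t| * M ≤ 1 / 4 := by
    rw [le_div_iff₀ (by positivity)] at ht; linarith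
  have hz : ∀ i, ((t : ℂ) * l i).re < 1 / 2 := by
    intro i
    have h1 := abs_le_of_powerSum_two_le hM.le h i
    have h2 : |t * l i| ≤ 1 / 4 := by
      rw [abs_mul]
      exact (mul_le_mul_of_nonneg_left h1 (abs_nonneg _)).trans ht'
    rw [← Complex.ofReal_mul, Complex.ofReal_re]
    linarith [le_abs_self (t * l i)]
  have hcast : ∀ x : ℝ, Complex.exp (t * x) = (Real.exp (t * x) : ℝ) := by
    intro x; push_cast; rfl
  have hint := integrable_cexp_chaosLaw l hz
  have hval := integral_cexp_chaosLaw l hz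
  simp_rw [hcast] at hint hval
  refine ⟨by simpa only [RCLike.re_to_complex, Complex.ofReal_re] using hint.re, ?_⟩
  rw [integral_complex_ofReal] at hval
  have hb : 2 * M * ‖(t : ℂ)‖ ≤ 1 / 2 := by
    rw [Complex.norm_real, Real.norm_eq_abs]; linarith
  have hs := hasSum_chaosCoeff hM.le h (z := t) (by linarith)
  have hn : ‖∑ i, squareCgf (t * l i)‖ ≤ 2 := by
    rw [← hs.tsum_eq]
    refine tsum_of_norm_bounded hasSum_geometric_two fun n => ?_
    rw [norm_mul, norm_pow, Complex.norm_real, Real.norm_eq_abs]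
    calc |chaosCoeff l n| * ‖(t : ℂ)‖ ^ n ≤ (2 * M) ^ n * ‖(t : ℂ)‖ ^ n := by
          gcongr; exact abs_chaosCoeff_le hM.le h n
      _ = (2 * M * ‖(t : ℂ)‖) ^ n := (mul_pow _ _ _).symm
      _ ≤ (1 / 2) ^ n := by gcongr
  calc ∫ x, Real.exp (t * x) ∂(chaosLaw l)
      ≤ ‖((∫ x, Real.exp (t * x) ∂(chaosLaw l) : ℝ) : ℂ)‖ := by
        rw [Complex.norm_real]; exact le_abs_self _
    _ ≤ Real.exp 2 := by
      rw [hval]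
      exact (Complex.norm_exp_le_exp_norm _).trans (Real.exp_le_exp.2 hn)

/-- Exponential moments pass to weak limits, by truncation. -/
lemma integrable_exp_mul_of_tendsto {ν : ℕ → ProbabilityMeasure ℝ} {μ : ProbabilityMeasure ℝ}
    (h : Tendsto ν atTop (𝓝 μ)) {t K : ℝ}
    (hint : ∀ n, Integrable (fun x => Real.exp (t * x)) (ν n : Measure ℝ))
    (hK : ∀ n, ∫ x, Real.exp (t * x) ∂(ν n : Measure ℝ) ≤ K) :
    Integrable (fun x => Real.exp (t * x)) (μ : Measure ℝ) := by
  have hbdd : ∀ (k : ℕ) (x : ℝ), ‖min (Real.exp (t * x)) k‖ ≤ k := by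
    intro k x
    rw [Real.norm_eq_abs, abs_of_nonneg (le_min (Real.exp_pos _).le (Nat.cast_nonneg _))]
    exact min_le_right _ _
  let f : ℕ → BoundedContinuousFunction ℝ ℝ := fun k =>
    BoundedContinuousFunction.ofNormedAddCommGroup (fun x => min (Real.exp (t * x)) k)
      (by fun_prop) k (hbdd k)
  have hf : ∀ k x, f k x = min (Real.exp (t * x)) k := fun _ _ => rfl
  have hle : ∀ k, ∫ x, f k x ∂(μ : Measure ℝ) ≤ K := by
    intro k
    refine le_of_tendsto'
      ((ProbabilityMeasure.tendsto_iff_forall_integral_tendsto.1 h) (f k)) fun n => ?_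
    exact (integral_mono ((f k).integrable _) (hint n) fun x => min_le_left _ _).trans (hK n)
  have hlim : ∀ x, Tendsto (fun k => f k x) atTop (𝓝 (Real.exp (t * x))) := by
    intro x
    refine tendsto_const_nhds.congr' ?_
    filter_upwards [eventually_ge_atTop ⌈Real.exp (t * x)⌉₊] with k hk
    rw [hf, min_eq_left ((Nat.le_ceil _).trans (by exact_mod_cast hk))]
  refine ⟨by fun_prop, ?_⟩
  have hfatou : ∫⁻ x, ‖Real.exp (t * x)‖ₑ ∂(μ : Measure ℝ) ≤ ENNReal.ofReal K := by
    have h1 : ∀ x, ‖Real.exp (t * x)‖ₑ = liminf (fun k => ‖f k x‖ₑ) atTop := fun x =>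
      ((continuous_enorm.tendsto _).comp (hlim x)).liminf_eq.symm
    simp_rw [h1]
    refine (lintegral_liminf_le fun k => by fun_prop).trans ?_
    refine liminf_le_of_le (by isBoundedDefault) fun b hb => ?_
    obtain ⟨k, hk⟩ := hb.exists
    refine hk.trans ?_
    rw [← ofReal_integral_norm_eq_lintegral_enorm ((f k).integrable _)]
    refine ENNReal.ofReal_le_ofReal (le_trans (le_of_eq ?_) (hle k))
    refine integral_congr_ae (.of_forall fun x => ?_)
    simp only [Real.norm_eq_abs]
    exact abs_of_nonneg (le_min (Real.exp_pos _).le (Nat.cast_nonneg _))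
  exact hfatou.trans_lt ENNReal.ofReal_lt_top

/-- If laws `chaosLaw (l n)` converge weakly, their cumulants converge to those of the limit.
The Taylor coefficients range in a compact product of intervals; along a subsequence on which they
converge, the limits are identified as cumulants by `iteratedDeriv_cgf_of_charFun`. -/
theorem tendsto_cumulant_of_tendsto_charFun {m : ℕ → ℕ} {l : ∀ n, Fin (m n) → ℝ} {μ : Measure ℝ}
    [IsProbabilityMeasure μ]
    (h : ∀ t, Tendsto (fun n => charFun (chaosLaw (l n)) t) atTop (𝓝 (charFun μ t))) (r : ℕ) :
    Tendsto (fun n => r.factorial * chaosCoeff (l n) r) atTop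
      (𝓝 (iteratedDeriv r (cgf id μ) 0)) := by
  obtain ⟨M, hM, hl⟩ := exists_powerSum_two_le h
  have hexp : ∀ t : ℝ, |t| ≤ 1 / (4 * M) → Integrable (fun x => Real.exp (t * x)) μ := by
    intro t ht
    have hw : Tendsto (β := ProbabilityMeasure ℝ) (fun n => ⟨chaosLaw (l n), inferInstance⟩) atTop
        (𝓝 ⟨μ, inferInstance⟩) := ProbabilityMeasure.tendsto_iff_tendsto_charFun.2 h
    exact integrable_exp_mul_of_tendsto hw (fun n => (integral_exp_mul_chaosLaw_le hM (hl n) ht).1)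
      fun n => (integral_exp_mul_chaosLaw_le hM (hl n) ht).2
  have hint : 0 ∈ interior (integrableExpSet id μ) := by
    rw [mem_interior_iff_mem_nhds]
    filter_upwards [Metric.closedBall_mem_nhds (0 : ℝ) (show 0 < 1 / (4 * M) by positivity)]
      with t ht
    exact hexp t (by simpa using ht)
  refine tendsto_of_subseq_tendsto fun ns hns => ?_
  have hK : IsCompact (Set.univ.pi fun n : ℕ => Set.Icc (-(2 * M) ^ n) ((2 * M) ^ n)) :=
    isCompact_univ_pi fun n => isCompact_Icc
  obtain ⟨a, ha, φ, hφ, hlim⟩ := hK.tendsto_subseq (x := fun n => chaosCoeff (l (ns n)))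
    fun n k _ => abs_le.1 (abs_chaosCoeff_le hM.le (hl (ns n)) k)
  refine ⟨φ, ?_⟩
  have hlim' := tendsto_pi_nhds.1 hlim
  have ha' : ∀ n, |a n| ≤ (2 * M) ^ n := fun n => abs_le.2 (ha n (Set.mem_univ n))
  rw [iteratedDeriv_cgf_of_charFun (B := ⟨2 * M, by positivity⟩) hint ha' ?_ r]
  · exact (hlim' r).const_mul _
  filter_upwards [Metric.closedBall_mem_nhds (0 : ℝ) (show 0 < 1 / (4 * M) by positivity)]
    with t ht
  have ht : |t| ≤ 1 / (4 * M) := by simpa using ht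
  have hb : 2 * M * ‖(t : ℂ) * Complex.I‖ ≤ 1 / 2 := by
    rw [le_div_iff₀ (by positivity)] at ht
    simp only [norm_mul, Complex.norm_real, Complex.norm_I, Real.norm_eq_abs, mul_one]
    linarith
  refine tendsto_nhds_unique ((h t).comp (hns.comp hφ.tendsto_atTop)) ?_
  have h1 : ∀ n, charFun (chaosLaw (l (ns (φ n)))) t =
      Complex.exp (∑' k, (chaosCoeff (l (ns (φ n))) k : ℂ) * (t * Complex.I) ^ k) := fun n => by
    rw [charFun_chaosLaw, (hasSum_chaosCoeff hM.le (hl _) (by linarith)).tsum_eq]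
  simp only [Function.comp_def, h1]
  refine (Complex.continuous_exp.tendsto _).comp ?_
  refine tendsto_tsum_of_dominated_convergence (bound := fun k : ℕ => (1 / 2 : ℝ) ^ k)
    summable_geometric_two (fun k => ?_) (.of_forall fun n k => ?_)
  · exact ((Complex.continuous_ofReal.tendsto _).comp (hlim' k)).mul_const _
  · rw [norm_mul, norm_pow, Complex.norm_real, Real.norm_eq_abs]
    calc _ ≤ (2 * M) ^ k * ‖(t : ℂ) * Complex.I‖ ^ k := by
          gcongr; exact abs_chaosCoeff_le hM.le (hl _) k
      _ = (2 * M * ‖(t : ℂ) * Complex.I‖) ^ k := (mul_pow _ _ _).symm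
      _ ≤ (1 / 2) ^ k := by gcongr

/-! ### Convergence of power sums implies weak convergence -/

/-- The quotient `squareCgf z / z ^ 2`, extended continuously to `z = 0`. -/
def squareCgfQuotient : ℂ → ℂ := dslope (dslope squareCgf 0) 0

lemma hasFPowerSeriesAt_squareCgf :
    HasFPowerSeriesAt squareCgf (FormalMultilinearSeries.ofScalars ℂ
      fun n => (chaosCoeff (fun _ : Fin 1 => (1 : ℝ)) n : ℂ)) 0 := by
  have h1 : powerSum (fun _ : Fin 1 => (1 : ℝ)) 2 ≤ 1 ^ 2 := by simp [powerSum]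
  refine (hasFPowerSeriesAt_tsum (a := chaosCoeff fun _ : Fin 1 => (1 : ℝ)) (B := 2)
    fun n => ?_).congr ?_
  · simpa using abs_chaosCoeff_le zero_le_one h1 n
  · filter_upwards [Metric.ball_mem_nhds (0 : ℂ) (show (0 : ℝ) < 1 / 2 by norm_num)] with z hz
    have hz' : 2 * 1 * ‖z‖ < 1 := by
      rw [mem_ball_zero_iff] at hz
      linarith
    simpa using (hasSum_chaosCoeff zero_le_one h1 hz').tsum_eq

lemma squareCgfQuotient_zero : squareCgfQuotient 0 = 1 := by
  have h := hasFPowerSeriesAt_squareCgf.has_fpower_series_dslope_fslope.has_fpower_series_dslope_fslope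
  have h0 := h.coeff_zero ![]
  rw [squareCgfQuotient, ← h0]
  have := (FormalMultilinearSeries.fslope (FormalMultilinearSeries.fslope
    (FormalMultilinearSeries.ofScalars ℂ
      fun n => (chaosCoeff (fun _ : Fin 1 => (1 : ℝ)) n : ℂ)))).apply_eq_prod_smul_coeff
      (n := 0) (y := ![])
  rw [this]
  simp [chaosCoeff, powerSum]

lemma squareCgf_eq (z : ℂ) : squareCgf z = z ^ 2 * squareCgfQuotient z := by
  have h0 : squareCgf 0 = 0 := by simp [squareCgf]
  have h1 : dslope squareCgf 0 0 = 0 := by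
    have h := hasFPowerSeriesAt_squareCgf.has_fpower_series_dslope_fslope
    rw [← h.coeff_zero ![], FormalMultilinearSeries.apply_eq_prod_smul_coeff]
    simp [chaosCoeff]
  have e1 := sub_smul_dslope squareCgf 0 z
  have e2 := sub_smul_dslope (dslope squareCgf 0) 0 z
  simp only [sub_zero, smul_eq_mul, h0, h1] at e1 e2
  rw [squareCgfQuotient, ← e1, ← e2]
  ring

lemma continuous_squareCgfQuotient (t : ℝ) :
    Continuous fun x : ℝ => squareCgfQuotient (t * Complex.I * x) := by
  set s : Set ℂ := {z | z.re < 1 / 2}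
  have hs : IsOpen s := isOpen_lt Complex.continuous_re continuous_const
  have hs0 : s ∈ 𝓝 (0 : ℂ) := hs.mem_nhds (by simp [s])
  have hd : DifferentiableOn ℂ squareCgf s := by
    intro z hz
    have : 1 - 2 * z ∈ Complex.slitPlane := by
      left
      have : z.re < 1 / 2 := hz
      simp; linarith
    unfold squareCgf
    exact (((by fun_prop : DifferentiableAt ℂ (fun z => 1 - 2 * z) z).clog this).neg.div_const 2
      |>.sub differentiableAt_id).differentiableWithinAt
  have hq : ContinuousOn squareCgfQuotient s :=
    ((Complex.differentiableOn_dslope hs0).2 ((Complex.differentiableOn_dslope hs0).2 hd)).continuousOn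
  exact hq.comp_continuous (by fun_prop) fun x => by simp [s]

section

variable {m : ℕ → ℕ} {l : ∀ n, Fin (m n) → ℝ} {k : ℕ} {L : Fin k → ℝ} {v : ℝ}

lemma tendsto_sum_sq_mul_eval (h : ∀ r, 2 ≤ r → Tendsto (fun n => powerSum (l n) r) atTop
      (𝓝 (powerSum L r + if r = 2 then v else 0))) (p : Polynomial ℝ) :
    Tendsto (fun n => ∑ i, l n i ^ 2 * p.eval (l n i)) atTop
      (𝓝 (∑ j, L j ^ 2 * p.eval (L j) + v * p.eval 0)) := by
  induction p using Polynomial.induction_on' with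
  | add p q hp hq =>
    convert hp.add hq using 1
    · ext n; simp [mul_add, Finset.sum_add_distrib]
    · simp only [Polynomial.eval_add, mul_add, Finset.sum_add_distrib]
      congr 1; ring
  | monomial k c =>
    convert (h (k + 2) (by omega)).const_mul c using 1
    · ext n
      simp only [Polynomial.eval_monomial, powerSum, Finset.mul_sum]
      exact Finset.sum_congr rfl fun i _ => by ring
    · congr 1
      simp only [Polynomial.eval_monomial, powerSum, mul_add, Finset.mul_sum]
      congr 1
      · exact Finset.sum_congr rfl fun i _ => by ring
      · rcases k with _ | k
        · simp; ring
        · simp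

/-- The measures `∑ i, l n i ^ 2 δ_{l n i}` live on a fixed compact interval; by the Weierstrass
approximation theorem, convergence of their moments is weak convergence. -/
lemma tendsto_sum_sq_mul (h : ∀ r, 2 ≤ r → Tendsto (fun n => powerSum (l n) r) atTop
      (𝓝 (powerSum L r + if r = 2 then v else 0))) {g : ℝ → ℝ} (hg : Continuous g) :
    Tendsto (fun n => ∑ i, l n i ^ 2 * g (l n i)) atTop
      (𝓝 (∑ j, L j ^ 2 * g (L j) + v * g 0)) := by
  obtain ⟨C, hC⟩ := (h 2 le_rfl).bddAbove_range
  have hCn : ∀ n, powerSum (l n) 2 ≤ C := fun n => hC ⟨n, rfl⟩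
  have hC0 : 0 ≤ C := (powerSum_two_nonneg (l 0)).trans (hCn 0)
  have hL0 := powerSum_two_nonneg L
  set M := √(C + powerSum L 2) with hM
  have hM2 : M ^ 2 = C + powerSum L 2 := Real.sq_sqrt (by positivity)
  have hM0 : 0 ≤ M := Real.sqrt_nonneg _
  have key : ∀ {κ : Type _} [Fintype κ] (w : κ → ℝ) (p : Polynomial ℝ) (δ : ℝ),
      powerSum w 2 ≤ M ^ 2 → (∀ x ∈ Set.Icc (-M) M, |p.eval x - g x| < δ) →
      |∑ i, w i ^ 2 * p.eval (w i) - ∑ i, w i ^ 2 * g (w i)| ≤ M ^ 2 * δ := by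
    intro κ _ w p δ hw hp
    have hδ : 0 ≤ δ := (abs_nonneg _).trans (hp 0 ⟨by linarith, hM0⟩).le
    rw [← Finset.sum_sub_distrib]
    calc _ ≤ ∑ i, |w i ^ 2 * p.eval (w i) - w i ^ 2 * g (w i)| := Finset.abs_sum_le_sum_abs _ _
      _ ≤ ∑ i, w i ^ 2 * δ := by
        refine Finset.sum_le_sum fun i _ => ?_
        rw [← mul_sub, abs_mul, abs_of_nonneg (sq_nonneg (w i))]
        gcongr
        exact (hp _ (abs_le.1 (abs_le_of_powerSum_two_le hM0 hw i))).le
      _ = powerSum w 2 * δ := by rw [powerSum, Finset.sum_mul]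
      _ ≤ M ^ 2 * δ := by gcongr
  rw [Metric.tendsto_atTop']
  intro ε hε
  set δ := ε / (3 * (M ^ 2 + |v| + 1)) with hδ
  have hδ0 : 0 < δ := by positivity
  obtain ⟨p, hp⟩ := exists_polynomial_near_of_continuousOn (-M) M g hg.continuousOn δ hδ0
  obtain ⟨n₀, hn₀⟩ := Metric.tendsto_atTop'.1 (tendsto_sum_sq_mul_eval h p) δ hδ0
  refine ⟨n₀, fun n hn => ?_⟩
  have h1 := key (l n) p δ (by rw [hM2]; linarith [hCn n]) hp
  have h2 := key L p δ (by rw [hM2]; linarith) hp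
  have h3 := hn₀ n hn
  have h4 : |v * p.eval 0 - v * g 0| ≤ |v| * δ := by
    rw [← mul_sub, abs_mul]
    gcongr
    exact (hp 0 ⟨by linarith, hM0⟩).le
  rw [Real.dist_eq] at h3 ⊢
  have h5 : 3 * (M ^ 2 + |v| + 1) * δ = ε := by rw [hδ]; field_simp
  have h6 : 0 ≤ M ^ 2 * δ := by positivity
  have h7 : 0 ≤ |v| * δ := by positivity
  rw [abs_lt] at h3 ⊢
  rw [abs_le] at h1 h2 h4
  constructor <;> linarith [h1.1, h1.2, h2.1, h2.2, h4.1, h4.2, h3.1, h3.2]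

lemma tendsto_charFun_chaosLaw (h : ∀ r, 2 ≤ r → Tendsto (fun n => powerSum (l n) r) atTop
      (𝓝 (powerSum L r + if r = 2 then v else 0))) (t : ℝ) :
    Tendsto (fun n => charFun (chaosLaw (l n)) t) atTop
      (𝓝 (Complex.exp (∑ j, squareCgf (t * Complex.I * L j) - t ^ 2 * v))) := by
  simp_rw [charFun_chaosLaw]
  refine (Complex.continuous_exp.tendsto _).comp ?_
  set H : ℝ → ℂ := fun x => -(t : ℂ) ^ 2 * squareCgfQuotient (t * Complex.I * x) with hHdef
  have hH : Continuous H := continuous_const.mul (continuous_squareCgfQuotient t)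
  have hsq : ∀ x : ℝ, squareCgf (t * Complex.I * x)
      = ((x ^ 2 * (H x).re : ℝ) : ℂ) + ((x ^ 2 * (H x).im : ℝ) : ℂ) * Complex.I := by
    intro x
    have : squareCgf (t * Complex.I * x) = (x : ℂ) ^ 2 * H x := by
      rw [squareCgf_eq, hHdef, mul_pow, mul_pow, Complex.I_sq]; ring
    rw [this]
    conv_lhs => rw [← Complex.re_add_im (H x)]
    push_cast; ring
  have hre := tendsto_sum_sq_mul h (g := fun x => (H x).re) (Complex.continuous_re.comp hH)
  have him := tendsto_sum_sq_mul h (g := fun x => (H x).im) (Complex.continuous_im.comp hH)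
  have h0 : H 0 = ((-t ^ 2 : ℝ) : ℂ) := by simp [hHdef, squareCgfQuotient_zero]
  have := ((Complex.continuous_ofReal.tendsto _).comp hre).add
    (((Complex.continuous_ofReal.tendsto _).comp him).mul_const Complex.I)
  convert this using 1
  · ext n
    simp only [hsq, Function.comp_apply, Finset.sum_add_distrib, Complex.ofReal_sum, Finset.sum_mul]
  · simp only [hsq, h0, Finset.sum_add_distrib, ← Finset.sum_mul, Complex.ofReal_re,
      Complex.ofReal_im, Complex.ofReal_sum, Complex.ofReal_add]
    congr 1
    push_cast; ring

end

lemma factorial_mul_chaosCoeff {ι : Type*} [Fintype ι] (l : ι → ℝ) {r : ℕ} (hr : 2 ≤ r) :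
    r.factorial * chaosCoeff l r = 2 ^ (r - 1) * (r - 1).factorial * powerSum l r := by
  rw [chaosCoeff, if_neg (by omega), ← Nat.mul_factorial_pred (by omega)]
  have : (r : ℝ) ≠ 0 := by exact_mod_cast (by omega : r ≠ 0)
  push_cast
  field_simp

/-- The cumulants of the sum of a weighted sum of centred Gaussian squares and of an independent
Gaussian variable of variance `2 v`. The Gaussian part is the weak limit of the laws with `n`
weights equal to `√(v / n)`. -/
theorem cumulant_of_charFun_eq {k : ℕ} {L : Fin k → ℝ} {v : ℝ} (hv : 0 ≤ v) {μ : Measure ℝ}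
    [IsProbabilityMeasure μ] (hμ : ∀ t : ℝ, charFun μ t =
      Complex.exp (∑ j, squareCgf (t * Complex.I * L j) - t ^ 2 * v)) {r : ℕ} (hr : 2 ≤ r) :
    iteratedDeriv r (cgf id μ) 0 = 2 ^ (r - 1) * (r - 1).factorial *
      (powerSum L r + if r = 2 then v else 0) := by
  set l : ∀ n : ℕ, Fin (k + (n + 1)) → ℝ := fun n =>
    Fin.append L fun _ => √(v / ((n + 1 : ℕ) : ℝ))
  have hl : ∀ r, 2 ≤ r → Tendsto (fun n => powerSum (l n) r) atTop
      (𝓝 (powerSum L r + if r = 2 then v else 0)) := by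
    intro r hr
    obtain ⟨s, rfl⟩ := Nat.exists_eq_add_of_le hr
    have h1 : ∀ n, powerSum (l n) (2 + s) =
        powerSum L (2 + s) + v * √(v / ((n + 1 : ℕ) : ℝ)) ^ s := by
      intro n
      have hn : ((n : ℝ) + 1) ≠ 0 := by positivity
      simp only [powerSum, l, Fin.sum_univ_add, Fin.append_left, Fin.append_right,
        Finset.sum_const, Finset.card_univ, Fintype.card_fin, nsmul_eq_mul]
      rw [pow_add, Real.sq_sqrt (by positivity)]
      push_cast
      field_simp
    simp_rw [h1]
    refine tendsto_const_nhds.add ?_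
    rcases s with _ | s
    · simp
    · have h2 : Tendsto (fun n : ℕ => v / ((n + 1 : ℕ) : ℝ)) atTop (𝓝 0) :=
        (tendsto_const_div_atTop_nhds_zero_nat v).comp (tendsto_add_atTop_nat 1)
      have h3 := (((Real.continuous_sqrt.tendsto _).comp h2).pow (s + 1)).const_mul v
      simpa using h3
  have hc := tendsto_cumulant_of_tendsto_charFun (μ := μ)
    (fun t => by rw [hμ]; exact tendsto_charFun_chaosLaw hl t) r
  simp_rw [factorial_mul_chaosCoeff _ hr] at hc
  exact tendsto_nhds_unique hc ((hl r hr).const_mul _)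

/-- `μ` is a limit of laws `chaosLaw l`, with an error on the characteristic functions that is
controlled as for an approximation of random variables in `L¹`. -/
def IsChaosLimit (μ : Measure ℝ) : Prop :=
  ∃ (m : ℕ → ℕ) (l : ∀ n, Fin (m n) → ℝ) (ε : ℕ → ℝ), Tendsto ε atTop (𝓝 0) ∧
    ∀ n t, ‖charFun (chaosLaw (l n)) t - charFun μ t‖ ≤ ε n * |t|

lemma IsChaosLimit.exists_approx {μ : Measure ℝ} [IsProbabilityMeasure μ] (hμ : IsChaosLimit μ)
    {ε : ℝ} (hε : 0 < ε) (k : ℕ) :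
    ∃ (m : ℕ) (l : Fin m → ℝ), (∀ t, ‖charFun (chaosLaw l) t - charFun μ t‖ ≤ ε * |t|) ∧
      ∀ r < k, |r.factorial * chaosCoeff l r - iteratedDeriv r (cgf id μ) 0| ≤ ε := by
  obtain ⟨m, l, δ, hδ, hl⟩ := hμ
  have hlim : ∀ t, Tendsto (fun n => charFun (chaosLaw (l n)) t) atTop (𝓝 (charFun μ t)) := by
    intro t
    rw [tendsto_iff_norm_sub_tendsto_zero]
    exact squeeze_zero (fun _ => norm_nonneg _) (fun n => hl n t) (by simpa using hδ.mul_const |t|)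
  have h1 : ∀ᶠ n in atTop, ∀ r < k,
      |r.factorial * chaosCoeff (l n) r - iteratedDeriv r (cgf id μ) 0| ≤ ε := by
    have h2 : ∀ᶠ n in atTop, ∀ r ∈ Finset.range k,
        |r.factorial * chaosCoeff (l n) r - iteratedDeriv r (cgf id μ) 0| ≤ ε := by
      rw [eventually_all_finset]
      intro r _
      filter_upwards [Metric.tendsto_nhds.1 (tendsto_cumulant_of_tendsto_charFun hlim r) ε hε]
        with n hn
      exact (Real.dist_eq _ _ ▸ hn).le
    simpa using h2
  obtain ⟨n, hn1, hn2⟩ := (h1.and (hδ.eventually (gt_mem_nhds hε))).exists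
  refine ⟨m n, l n, fun t => (hl n t).trans ?_, hn1⟩
  gcongr

/-- A sequence of limits of laws `chaosLaw l` can be replaced by a sequence of such laws, without
changing the asymptotics of characteristic functions and cumulants. -/
lemma exists_chaosLaw_seq {μ : ℕ → Measure ℝ} [∀ n, IsProbabilityMeasure (μ n)]
    (hμ : ∀ n, IsChaosLimit (μ n)) :
    ∃ (m : ℕ → ℕ) (l : ∀ n, Fin (m n) → ℝ),
      (∀ t, Tendsto (fun n => charFun (chaosLaw (l n)) t - charFun (μ n) t) atTop (𝓝 0)) ∧
      ∀ r, Tendsto (fun n => r.factorial * chaosCoeff (l n) r - iteratedDeriv r (cgf id (μ n)) 0)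
        atTop (𝓝 0) := by
  choose m l h1 h2 using fun n : ℕ =>
    (hμ n).exists_approx (show (0 : ℝ) < 1 / ((n : ℝ) + 1) by positivity) n
  have hz : Tendsto (fun n : ℕ => 1 / ((n : ℝ) + 1)) atTop (𝓝 0) :=
    tendsto_one_div_add_atTop_nhds_zero_nat
  refine ⟨m, l, fun t => ?_, fun r => ?_⟩
  · exact squeeze_zero_norm (fun n => h1 n t) (by simpa using hz.mul_const |t|)
  · refine squeeze_zero_norm' ?_ hz
    filter_upwards [eventually_gt_atTop r] with n hn
    exact h2 n r hn

/-! ### Convergence of finitely many power sums -/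

section

open Polynomial

variable {m : ℕ → ℕ} (l : ∀ n, Fin (m n) → ℝ) {k : ℕ} (L : Fin k → ℝ) (v : ℝ)

/-- The polynomials whose integrals against the measures `∑ i, l n i ^ 2 δ_{l n i}` converge to the
integral against `∑ j, L j ^ 2 δ_{L j} + v δ_0`. -/
def convergentPolynomials : Submodule ℝ ℝ[X] where
  carrier := {p | Tendsto (fun n => ∑ i, l n i ^ 2 * p.eval (l n i)) atTop
    (𝓝 (∑ j, L j ^ 2 * p.eval (L j) + v * p.eval 0))}
  zero_mem' := by simp
  add_mem' {p q} hp hq := by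
    simp only [Set.mem_ofPred_eq] at hp hq ⊢
    convert hp.add hq using 1
    · ext n; simp [mul_add, Finset.sum_add_distrib]
    · simp only [Polynomial.eval_add, mul_add, Finset.sum_add_distrib]
      congr 1; ring
  smul_mem' c p hp := by
    simp only [Set.mem_ofPred_eq] at hp ⊢
    convert hp.const_mul c using 1
    · ext n; simp [Finset.mul_sum, mul_left_comm]
    · simp [Finset.mul_sum, mul_left_comm, mul_add]

variable {l L v}

lemma mem_convergentPolynomials {p : ℝ[X]} : p ∈ convergentPolynomials l L v ↔
    Tendsto (fun n => ∑ i, l n i ^ 2 * p.eval (l n i)) atTop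
      (𝓝 (∑ j, L j ^ 2 * p.eval (L j) + v * p.eval 0)) := Iff.rfl

lemma X_pow_mem_convergentPolynomials {r : ℕ} : X ^ r ∈ convergentPolynomials l L v ↔
    Tendsto (fun n => powerSum (l n) (r + 2)) atTop
      (𝓝 (powerSum L (r + 2) + if r = 0 then v else 0)) := by
  rw [mem_convergentPolynomials]
  have h1 : ∀ {κ : Type} [Fintype κ] (w : κ → ℝ),
      ∑ i, w i ^ 2 * (X ^ r : ℝ[X]).eval (w i) = powerSum w (r + 2) := by
    intro κ _ w
    refine Finset.sum_congr rfl fun i _ => ?_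
    rw [eval_pow, eval_X]; ring
  simp_rw [h1]
  rcases r with _ | r <;> simp

/-- By the Cauchy-Schwarz inequality, if the integrals of `R ^ 2` tend to `0`, then so do those of
all multiples of `R`. -/
lemma tendsto_sum_sq_mul_mul_eval {R : ℝ[X]} {M : ℝ} (hM : 0 ≤ M)
    (hl : ∀ n, powerSum (l n) 2 ≤ M ^ 2)
    (hR : Tendsto (fun n => ∑ i, l n i ^ 2 * R.eval (l n i) ^ 2) atTop (𝓝 0)) (q : ℝ[X]) :
    Tendsto (fun n => ∑ i, l n i ^ 2 * (R * q).eval (l n i)) atTop (𝓝 0) := by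
  obtain ⟨B, hB⟩ := (isCompact_Icc (a := -M) (b := M)).exists_bound_of_continuousOn
    (f := fun x => q.eval x ^ 2) (by fun_prop)
  have hB0 : 0 ≤ B := (norm_nonneg _).trans (hB 0 ⟨by linarith, hM⟩)
  have hq : ∀ n, ∑ i, (l n i * q.eval (l n i)) ^ 2 ≤ M ^ 2 * B := by
    intro n
    calc _ ≤ ∑ i, l n i ^ 2 * B := by
          refine Finset.sum_le_sum fun i _ => ?_
          rw [mul_pow]
          gcongr
          exact (le_abs_self _).trans (hB _ (abs_le.1 (abs_le_of_powerSum_two_le hM (hl n) i)))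
      _ = powerSum (l n) 2 * B := by rw [powerSum, Finset.sum_mul]
      _ ≤ M ^ 2 * B := by gcongr; exact hl n
  refine squeeze_zero_norm (a := fun n =>
    √((∑ i, l n i ^ 2 * R.eval (l n i) ^ 2) * (M ^ 2 * B))) (fun n => ?_) ?_
  · refine Real.le_sqrt_of_sq_le ?_
    rw [Real.norm_eq_abs, sq_abs]
    have h1 := Finset.sum_mul_sq_le_sq_mul_sq Finset.univ (fun i => l n i * R.eval (l n i))
      (fun i => l n i * q.eval (l n i))
    have h2 : ∑ i, l n i ^ 2 * (R * q).eval (l n i) =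
        ∑ i, l n i * R.eval (l n i) * (l n i * q.eval (l n i)) :=
      Finset.sum_congr rfl fun i _ => by rw [eval_mul]; ring
    have h3 : ∑ i, l n i ^ 2 * R.eval (l n i) ^ 2 = ∑ i, (l n i * R.eval (l n i)) ^ 2 :=
      Finset.sum_congr rfl fun i _ => by ring
    rw [h2, h3]
    exact h1.trans (mul_le_mul_of_nonneg_left (hq n) (Finset.sum_nonneg fun _ _ => sq_nonneg _))
  · simpa [Function.comp_def] using (Real.continuous_sqrt.tendsto _).comp (hR.mul_const (M ^ 2 * B))

lemma sum_eval_eq_sum_coeff_mul_powerSum {ι : Type*} [Fintype ι] (w : ι → ℝ) (Q : ℝ[X])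
    (h0 : Q.coeff 0 = 0) (h1 : Q.coeff 1 = 0) :
    ∑ i, Q.eval (w i) = Q.coeff 2 * powerSum w 2
      + ∑ r ∈ Finset.Icc 3 Q.natDegree, Q.coeff r * powerSum w r := by
  have hsub : Finset.Icc 3 Q.natDegree ⊆ Finset.range (Q.natDegree + 3) := fun r hr => by
    simp only [Finset.mem_Icc, Finset.mem_range] at hr ⊢; omega
  have h2 : ∑ i, Q.eval (w i) = ∑ r ∈ Finset.range (Q.natDegree + 3), Q.coeff r * powerSum w r := by
    simp_rw [eval_eq_sum_range' (show Q.natDegree < Q.natDegree + 3 by omega), powerSum,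
      Finset.mul_sum]
    exact Finset.sum_comm
  have h3 : insert 2 (Finset.Icc 3 Q.natDegree) ⊆ Finset.range (Q.natDegree + 3) := fun r hr => by
    simp only [Finset.mem_insert, Finset.mem_Icc, Finset.mem_range] at hr ⊢; omega
  rw [h2, ← Finset.sum_insert (f := fun r => Q.coeff r * powerSum w r) (by simp)]
  refine (Finset.sum_subset h3 fun r _ hr => ?_).symm
  simp only [Finset.mem_insert, Finset.mem_Icc, not_or, not_and, not_le] at hr
  rcases lt_trichotomy r 2 with h | h | h
  · interval_cases r <;> simp [h0, h1]
  · exact absurd h hr.1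
  · rw [coeff_eq_zero_of_natDegree_lt (hr.2 h), zero_mul]

/-- Under the hypotheses, the limit points of the measures `∑ i, l n i ^ 2 δ_{l n i}` live on the
zeros of `Q / X ^ 2`, because `Q / X ^ 2` is nonnegative and its integrals tend to `0`. Their masses
are given by the remaining conditions, through a Vandermonde system. In terms of polynomials: modulo
the squarefree polynomial `R` with `Q = X ^ 2 * R ^ 2`, every polynomial is a combination of the
test functions `1` and `X ^ r`, `s ≤ r + 2 < s + #E`. -/
theorem tendsto_powerSum_of_tendsto_testPolynomial {E : Finset ℝ} {d s : ℕ}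
    (hE : ∀ x, x ∈ E ↔ ∃ j, L j = x) (h0 : (0 : ℝ) ∉ E)
    (hd : d = 0 ∧ v = 0 ∨ d = 1) (hs : 2 * (1 + d) ≤ s) {Q : ℝ[X]}
    (hQ : Q = X ^ (2 * (1 + d)) * ∏ x ∈ E, (X - C x) ^ 2)
    (h2 : Tendsto (fun n => powerSum (l n) 2) atTop (𝓝 (powerSum L 2 + v)))
    (htest : Tendsto
      (fun n => ∑ r ∈ Finset.Icc 3 Q.natDegree, Q.coeff r * powerSum (l n) r) atTop
      (𝓝 (∑ r ∈ Finset.Icc 3 Q.natDegree, Q.coeff r * powerSum L r)))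
    (hcons : ∀ r ∈ Finset.Ico s (s + E.card),
      Tendsto (fun n => powerSum (l n) r) atTop (𝓝 (powerSum L r))) {r : ℕ} (hr : 2 ≤ r) :
    Tendsto (fun n => powerSum (l n) r) atTop
      (𝓝 (powerSum L r + if r = 2 then v else 0)) := by
  set R : ℝ[X] := X ^ d * ∏ x ∈ E, (X - C x) with hRdef
  have hQR : Q = X ^ 2 * R ^ 2 := by
    rw [hQ, hRdef, Finset.prod_pow]; ring
  have hRE : ∀ x ∈ E, R.eval x = 0 := by
    intro x hx
    rw [hRdef, eval_mul, eval_prod, Finset.prod_eq_zero hx (by simp), mul_zero]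
  have hRv : v * R.eval 0 = 0 := by
    rcases hd with ⟨_, hv⟩ | hd
    · simp [hv]
    · simp [hRdef, hd]
  have hL0 : ∀ j, L j ∈ E := fun j => (hE _).2 ⟨j, rfl⟩
  -- the integrals of `R ^ 2` tend to `0`
  have hR2 : Tendsto (fun n => ∑ i, l n i ^ 2 * R.eval (l n i) ^ 2) atTop (𝓝 0) := by
    have hc0 : Q.coeff 0 = 0 := by rw [hQR, coeff_X_pow_mul', if_neg (by norm_num)]
    have hc1 : Q.coeff 1 = 0 := by rw [hQR, coeff_X_pow_mul', if_neg (by norm_num)]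
    have hc2 : Q.coeff 2 = R.eval 0 ^ 2 := by
      rw [hQR, coeff_X_pow_mul', if_pos le_rfl, Nat.sub_self, coeff_zero_eq_eval_zero, eval_pow]
    have hlim := (h2.const_mul (Q.coeff 2)).add htest
    have hzero : Q.coeff 2 * (powerSum L 2 + v) +
        ∑ r ∈ Finset.Icc 3 Q.natDegree, Q.coeff r * powerSum L r = 0 := by
      have h3 := sum_eval_eq_sum_coeff_mul_powerSum L Q hc0 hc1
      have h4 : ∑ j, Q.eval (L j) = 0 := Finset.sum_eq_zero fun j _ => by
        rw [hQR, eval_mul, eval_pow, eval_pow, hRE _ (hL0 j)]; simp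
      have h5 : Q.coeff 2 * v = 0 := by rw [hc2]; linear_combination R.eval 0 * hRv
      linarith
    rw [hzero] at hlim
    refine hlim.congr fun n => ?_
    rw [← sum_eval_eq_sum_coeff_mul_powerSum (l n) Q hc0 hc1]
    exact Finset.sum_congr rfl fun i _ => by rw [hQR]; simp
  obtain ⟨M, hM, hl⟩ : ∃ M : ℝ, 0 ≤ M ∧ ∀ n, powerSum (l n) 2 ≤ M ^ 2 := by
    obtain ⟨B, hB⟩ := h2.bddAbove_range
    refine ⟨√B, Real.sqrt_nonneg _, fun n => ?_⟩
    have hBn : powerSum (l n) 2 ≤ B := hB ⟨n, rfl⟩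
    rwa [Real.sq_sqrt ((powerSum_two_nonneg _).trans hBn)]
  have hmul : ∀ q, R * q ∈ convergentPolynomials l L v := by
    intro q
    rw [mem_convergentPolynomials]
    convert tendsto_sum_sq_mul_mul_eval hM hl hR2 q using 2
    have h3 : ∑ j, L j ^ 2 * (R * q).eval (L j) = 0 := Finset.sum_eq_zero fun j _ => by
      rw [eval_mul, hRE _ (hL0 j)]; simp
    rw [h3, eval_mul, ← mul_assoc, hRv]; simp
  have hone : (1 : ℝ[X]) ∈ convergentPolynomials l L v := by
    rw [← pow_zero X, X_pow_mem_convergentPolynomials]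
    simpa using h2
  have hpow : ∀ i < E.card, X ^ (s - 2 + i) ∈ convergentPolynomials l L v := by
    intro i hi
    rw [X_pow_mem_convergentPolynomials]
    have h3 := hcons (s - 2 + i + 2) (by rw [Finset.mem_Ico]; omega)
    split_ifs with h4
    · -- the exponent `0` occurs only if `s = 2`
      rcases hd with ⟨_, hv⟩ | hd
      · simpa [hv] using h3
      · omega
    · simpa using h3
  have hall : ∀ p, p ∈ convergentPolynomials l L v := by
    intro p
    set α : ℝ := if d = 0 then 0 else p.eval 0 with hα
    set u := Lagrange.interpolate E id (fun x => (p.eval x - α) / x ^ (s - 2)) with hu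
    have hdeg : u.degree < E.card := Lagrange.degree_interpolate_lt _ Function.injective_id.injOn
    have hXu : X ^ (s - 2) * u ∈ convergentPolynomials l L v := by
      rw [← u.sum_C_mul_X_pow_eq, Polynomial.sum, Finset.mul_sum]
      refine Submodule.sum_mem _ fun i hi => ?_
      have hi' : i < E.card := by
        by_contra hcon
        exact (mem_support_iff.1 hi) (coeff_eq_zero_of_degree_lt
          (hdeg.trans_le (by exact_mod_cast not_lt.1 hcon)))
      have : X ^ (s - 2) * (C (u.coeff i) * X ^ i) = u.coeff i • (X ^ (s - 2 + i) : ℝ[X]) := by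
        rw [smul_eq_C_mul, pow_add]; ring
      rw [this]
      exact Submodule.smul_mem _ _ (hpow i hi')
    set w := p - α • (1 : ℝ[X]) - X ^ (s - 2) * u with hw
    have hwE : ∀ x ∈ E, w.eval x = 0 := by
      intro x hx
      have hx0 : x ≠ 0 := fun h => h0 (h ▸ hx)
      have : u.eval x = (p.eval x - α) / x ^ (s - 2) := by
        exact Lagrange.eval_interpolate_at_node (v := id)
          (fun x => (p.eval x - α) / x ^ (s - 2)) Function.injective_id.injOn hx
      rw [hw]
      simp only [eval_sub, eval_smul, eval_one, eval_mul, eval_pow, eval_X, this, smul_eq_mul]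
      field_simp
      ring
    have hdvd : R ∣ w := by
      have hprod : ∀ Z : Finset ℝ, (∀ x ∈ Z, w.eval x = 0) → ∏ x ∈ Z, (X - C x) ∣ w :=
        fun Z hZ => Finset.prod_dvd_of_coprime
          (fun x _ y _ hxy => pairwise_coprime_X_sub_C Function.injective_id hxy)
          fun x hx => dvd_iff_isRoot.2 (hZ x hx)
      rcases hd with ⟨hd, _⟩ | hd
      · rw [hRdef, hd, pow_zero, one_mul]
        exact hprod E hwE
      · have h3 : R = ∏ x ∈ insert 0 E, (X - C x) := by
          rw [Finset.prod_insert h0, hRdef, hd]; simp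
        rw [h3]
        refine hprod _ fun x hx => ?_
        rcases Finset.mem_insert.1 hx with rfl | hx
        · have : s - 2 ≠ 0 := by omega
          simp [hw, hα, hd, this]
        · exact hwE x hx
    obtain ⟨q, hq⟩ := hdvd
    have hp : p = R * q + α • (1 : ℝ[X]) + X ^ (s - 2) * u := by rw [← hq, hw]; ring
    rw [hp]
    exact add_mem (add_mem (hmul q) (Submodule.smul_mem _ _ hone)) hXu
  obtain ⟨t, rfl⟩ := Nat.exists_eq_add_of_le' hr
  simpa using X_pow_mem_convergentPolynomials.1 (hall (X ^ t))

end

/-! ### Traces of powers -/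

section Trace

open Matrix

variable {m n : Type*} [Fintype m] [Fintype n] [DecidableEq m] [DecidableEq n]

lemma mul_pow_succ_rect (A : Matrix m n ℝ) (B : Matrix n m ℝ) (r : ℕ) :
    (A * B) ^ (r + 1) = A * (B * A) ^ r * B := by
  induction r with
  | zero => simp
  | succ r ih => rw [pow_succ, ih, pow_succ]; simp only [Matrix.mul_assoc]

lemma trace_mul_pow_succ_comm (A : Matrix m n ℝ) (B : Matrix n m ℝ) (r : ℕ) :
    ((A * B) ^ (r + 1)).trace = ((B * A) ^ (r + 1)).trace := by
  rw [mul_pow_succ_rect, Matrix.mul_assoc, Matrix.trace_mul_comm, Matrix.mul_assoc, ← pow_succ]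

lemma trace_diagonal_pow (l : m → ℝ) (r : ℕ) : (diagonal l ^ r).trace = powerSum l r := by
  simp [diagonal_pow, powerSum]

lemma powerSum_eigenvalues {A : Matrix m m ℝ} (hA : A.IsHermitian) (r : ℕ) :
    powerSum hA.eigenvalues (r + 1) = (A ^ (r + 1)).trace := by
  have h := hA.spectral_theorem
  rw [Unitary.conjStarAlgAut_apply] at h
  conv_rhs => rw [h, Matrix.mul_assoc, trace_mul_pow_succ_comm, Matrix.mul_assoc]
  rw [Unitary.coe_star_mul_self, Matrix.mul_one, ← trace_diagonal_pow]
  rfl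

/-- A quadratic form in a standard Gaussian vector has the law of the sum of the squares of its
coordinates, weighted by the eigenvalues: the standard Gaussian law is rotation invariant. -/
lemma map_quadraticForm_gaussian {A : Matrix m m ℝ} (hA : A.IsHermitian) (htr : A.trace = 0) :
    (Measure.pi fun _ : m => gaussianReal 0 1).map (fun x => ∑ i, ∑ j, A i j * x i * x j)
      = chaosLaw hA.eigenvalues := by
  set b := hA.eigenvectorBasis
  set q : EuclideanSpace ℝ m → ℝ := fun x => ∑ i, ∑ j, A i j * x i * x j with hq
  have hqm : Measurable q := by
    refine Finset.measurable_sum _ fun i _ => Finset.measurable_sum _ fun j _ => ?_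
    fun_prop
  have h1 : (fun x : m → ℝ => ∑ i, ∑ j, A i j * x i * x j) = q ∘ WithLp.toLp 2 := rfl
  rw [h1, ← Measure.map_map hqm (by fun_prop), map_pi_eq_stdGaussian,
    stdGaussian_eq_map_pi_orthonormalBasis b, Measure.map_map hqm
      (Finset.measurable_sum _ fun i _ => by fun_prop), chaosLaw]
  congr 1
  ext x
  have h2 : ∀ y : EuclideanSpace ℝ m, q y = inner ℝ y (toEuclideanLin A y) := by
    intro y
    simp only [hq, PiLp.inner_apply, toLpLin_apply, mulVec, dotProduct, RCLike.inner_apply,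
      conj_trivial, Finset.sum_mul]
    exact Finset.sum_congr rfl fun i _ => Finset.sum_congr rfl fun j _ => by ring
  have h3 : ∀ i, toEuclideanLin A (b i) = hA.eigenvalues i • b i := by
    intro i
    rw [toLpLin_apply, hA.mulVec_eigenvectorBasis]
    rfl
  have h4 : ∑ i, hA.eigenvalues i = 0 := by
    have := powerSum_eigenvalues hA 0
    simpa [powerSum, htr] using this
  rw [Function.comp_apply, h2, map_sum]
  simp_rw [map_smul, h3, smul_smul]
  rw [b.orthonormal.inner_sum]
  simp_rw [mul_sub, mul_one, Finset.sum_sub_distrib, h4, sub_zero]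
  exact Finset.sum_congr rfl fun i _ => by simp; ring

end Trace

/-! ### The law of the double integral of a step kernel -/

namespace StepKernel

open Matrix

variable (g : StepKernel)

/-- The length of the `i`-th interval of the subdivision. -/
def length (i : Fin g.size) : ℝ := g.time i.succ - g.time i.castSucc

lemma length_nonneg (i : Fin g.size) : 0 ≤ g.length i :=
  sub_nonneg.2 (by exact_mod_cast g.time_mono (Fin.castSucc_le_succ i))

/-- The matrix of the step kernel with respect to the normalized indicator functions of the
intervals of the subdivision. -/
def normalizedMatrix : Matrix (Fin g.size) (Fin g.size) ℝ :=
  diagonal (fun i => √(g.length i)) * (g.coeff * diagonal fun i => √(g.length i))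

lemma normalizedMatrix_apply (i j : Fin g.size) :
    g.normalizedMatrix i j = √(g.length i) * g.coeff i j * √(g.length j) := by
  simp [normalizedMatrix, mul_assoc]

lemma isHermitian_normalizedMatrix : g.normalizedMatrix.IsHermitian := by
  ext i j
  rw [conjTranspose_apply, normalizedMatrix_apply, normalizedMatrix_apply, star_trivial,
    g.coeff_symm.apply]
  ring

lemma trace_normalizedMatrix : g.normalizedMatrix.trace = 0 := by
  simp [trace, normalizedMatrix_apply, g.coeff_diag]

/-- The eigenvalues of the step kernel. -/
def eigenvalues : Fin g.size → ℝ := g.isHermitian_normalizedMatrix.eigenvalues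

lemma powerSum_eigenvalues (r : ℕ) :
    powerSum g.eigenvalues (r + 1) = ((g.coeff * diagonal g.length) ^ (r + 1)).trace := by
  rw [eigenvalues, SecondChaos.powerSum_eigenvalues, normalizedMatrix, trace_mul_pow_succ_comm,
    Matrix.mul_assoc, diagonal_mul_diagonal]
  simp_rw [Real.mul_self_sqrt (g.length_nonneg _)]

variable {Ω : Type*} [MeasurableSpace Ω] {P : Measure Ω} {W : ℝ≥0 → Ω → ℝ}

lemma aemeasurable_integral (hW : IsPreBrownianReal W P) : AEMeasurable (g.integral W) P := by
  have h := hW.aemeasurable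
  refine Finset.aemeasurable_fun_sum _ fun i _ => Finset.aemeasurable_fun_sum _ fun j _ => ?_
  exact ((((h _).sub (h _)).const_mul _).mul ((h _).sub (h _)))

lemma map_integral (hW : IsPreBrownianReal W P) :
    P.map (g.integral W) = chaosLaw g.eigenvalues := by
  have : IsProbabilityMeasure P := hW.isGaussianProcess.isProbabilityMeasure
  set Y : Fin g.size → Ω → ℝ := fun i ω => W (g.time i.succ) ω - W (g.time i.castSucc) ω with hY
  have hYm : ∀ i, AEMeasurable (Y i) P := fun i => (hW.aemeasurable _).sub (hW.aemeasurable _)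
  have hYlaw : ∀ i, P.map (Y i) = (gaussianReal 0 1).map (√(g.length i) * ·) := by
    intro i
    have h1 := (hW.hasLaw_sub (g.time i.succ) (g.time i.castSucc)).map_eq
    rw [gaussianReal_map_const_mul, mul_zero, mul_one]
    refine h1.trans ?_
    congr 1
    ext
    have h2 := g.length_nonneg i
    simp only [coe_nndist, NNReal.coe_mk, Real.sq_sqrt h2]
    exact abs_of_nonneg h2
  have hind : iIndepFun Y P := hW.hasIndepIncrements g.size g.time g.time_mono
  have hmap : P.map (fun ω i => Y i ω) = (Measure.pi fun _ : Fin g.size => gaussianReal 0 1).map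
      (fun x i => √(g.length i) * x i) := by
    rw [(iIndepFun_iff_map_fun_eq_pi_map hYm).1 hind]
    simp_rw [hYlaw]
    exact (Measure.pi_map_pi (f := fun i y => √(g.length i) * y) (fun i => by fun_prop)).symm
  set q : (Fin g.size → ℝ) → ℝ := fun x => ∑ i, ∑ j, g.coeff i j * x i * x j with hq
  have hqm : Measurable q := by
    refine Finset.measurable_sum _ fun i _ => Finset.measurable_sum _ fun j _ => ?_
    fun_prop
  have h1 : g.integral W = q ∘ fun ω i => Y i ω := rfl
  rw [h1, ← AEMeasurable.map_map_of_aemeasurable hqm.aemeasurable (aemeasurable_pi_lambda _ hYm),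
    hmap, Measure.map_map hqm (by fun_prop), eigenvalues,
    ← map_quadraticForm_gaussian _ g.trace_normalizedMatrix]
  congr 1
  ext x
  refine Finset.sum_congr rfl fun i _ => Finset.sum_congr rfl fun j _ => ?_
  rw [normalizedMatrix_apply]
  ring

end StepKernel

/-! ### Passage to the limit in the double integral -/

section DoubleIntegral

variable {Ω : Type*} [MeasurableSpace Ω] {P : Measure Ω} [IsProbabilityMeasure P]

lemma norm_charFun_map_sub_le {X Y : Ω → ℝ} (hX : AEMeasurable X P) (hY : AEMeasurable Y P)
    (hfin : eLpNorm (fun ω => X ω - Y ω) 2 P ≠ ∞) (t : ℝ) :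
    ‖charFun (P.map X) t - charFun (P.map Y) t‖ ≤
      (eLpNorm (fun ω => X ω - Y ω) 2 P).toReal * |t| := by
  have hm : AEStronglyMeasurable (fun ω => X ω - Y ω) P := (hX.sub hY).aestronglyMeasurable
  have hmem : MemLp (fun ω => X ω - Y ω) 2 P := ⟨hm, lt_top_iff_ne_top.2 hfin⟩
  have hint : Integrable (fun ω => X ω - Y ω) P := hmem.integrable (by norm_num)
  have hexp : ∀ Z : Ω → ℝ, AEMeasurable Z P →
      Integrable (fun ω => Complex.exp (t * Z ω * Complex.I)) P := by
    intro Z hZ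
    refine (integrable_const (1 : ℝ)).mono' (by fun_prop) (.of_forall fun ω => ?_)
    rw [← Complex.ofReal_mul, Complex.norm_exp_ofReal_mul_I]
  rw [charFun_apply_real, charFun_apply_real, integral_map hX (by fun_prop),
    integral_map hY (by fun_prop), ← integral_sub (hexp X hX) (hexp Y hY)]
  have hle : ∀ ω, ‖Complex.exp (t * X ω * Complex.I) - Complex.exp (t * Y ω * Complex.I)‖ ≤
      |t| * ‖X ω - Y ω‖ := by
    intro ω
    have h1 : Complex.exp (t * X ω * Complex.I) - Complex.exp (t * Y ω * Complex.I) =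
        Complex.exp ((t * Y ω : ℝ) * Complex.I) *
          (Complex.exp (Complex.I * (t * (X ω - Y ω) : ℝ)) - 1) := by
      rw [mul_sub, mul_one, ← Complex.exp_add]
      push_cast
      ring_nf
    rw [h1, norm_mul, Complex.norm_exp_ofReal_mul_I, one_mul, Real.norm_eq_abs, ← abs_mul,
      ← Real.norm_eq_abs]
    exact Real.norm_exp_I_mul_ofReal_sub_one_le
  calc _ ≤ ∫ ω, |t| * ‖X ω - Y ω‖ ∂P :=
        norm_integral_le_of_norm_le (hint.norm.const_mul _) (.of_forall hle)
    _ = |t| * (eLpNorm (fun ω => X ω - Y ω) 1 P).toReal := by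
        rw [integral_const_mul, integral_norm_eq_lintegral_enorm hm, eLpNorm_one_eq_lintegral_enorm]
    _ ≤ (eLpNorm (fun ω => X ω - Y ω) 2 P).toReal * |t| := by
        rw [mul_comm]
        gcongr
        exact eLpNorm_le_eLpNorm_of_exponent_le (by norm_num) hm

lemma tendsto_charFun_of_tendsto_eLpNorm {X : ℕ → Ω → ℝ} {Y : Ω → ℝ}
    (hX : ∀ n, AEMeasurable (X n) P) (hY : AEMeasurable Y P)
    (h : Tendsto (fun n => eLpNorm (fun ω => X n ω - Y ω) 2 P) atTop (𝓝 0)) (t : ℝ) :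
    Tendsto (fun n => charFun (P.map (X n)) t) atTop (𝓝 (charFun (P.map Y) t)) := by
  rw [tendsto_iff_norm_sub_tendsto_zero]
  have h1 := ((ENNReal.tendsto_toReal ENNReal.zero_ne_top).comp h).mul_const |t|
  rw [ENNReal.toReal_zero, zero_mul] at h1
  refine squeeze_zero' (.of_forall fun _ => norm_nonneg _) ?_ h1
  filter_upwards [h.eventually (gt_mem_nhds ENNReal.zero_lt_top)] with n hn
  exact norm_charFun_map_sub_le (hX n) hY hn.ne t

variable {W : ℝ≥0 → Ω → ℝ} {f : L2Quadrant} {F : Ω → ℝ}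

/-- The law of a double Wiener-Itô integral is a limit of laws of double integrals of step
kernels. -/
lemma IsDoubleIntegral.isChaosLimit (hW : IsPreBrownianReal W P) (hF : IsDoubleIntegral W P f F) :
    IsChaosLimit (P.map F) := by
  obtain ⟨hF2, g, -, hg⟩ := hF
  obtain ⟨n₀, hn₀⟩ := eventually_atTop.1 (hg.eventually (gt_mem_nhds ENNReal.zero_lt_top))
  refine ⟨fun n => (g (n + n₀)).size, fun n => (g (n + n₀)).eigenvalues,
    fun n => (eLpNorm (fun ω => (g (n + n₀)).integral W ω - F ω) 2 P).toReal, ?_, fun n t => ?_⟩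
  · rw [← ENNReal.toReal_zero]
    exact (ENNReal.tendsto_toReal ENNReal.zero_ne_top).comp (hg.comp (tendsto_add_atTop_nat n₀))
  · rw [← StepKernel.map_integral _ hW]
    exact norm_charFun_map_sub_le (StepKernel.aemeasurable_integral _ hW)
      hF2.aestronglyMeasurable.aemeasurable (hn₀ _ (by omega)).ne t

/-- A random variable independent of the Brownian motion is independent of the double integrals of
step kernels, and the factorization of the characteristic function of the sum passes to the
limit. -/
lemma IsDoubleIntegral.charFun_map_add (hW : IsPreBrownianReal W P)
    (hF : IsDoubleIntegral W P f F) {N : Ω → ℝ} (hN : AEMeasurable N P)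
    (hindep : IndepFun N (fun ω t => W t ω) P) (t : ℝ) :
    charFun (P.map (N + F)) t = charFun (P.map N) t * charFun (P.map F) t := by
  obtain ⟨hF2, g, -, hg⟩ := hF
  have hFm := hF2.aestronglyMeasurable.aemeasurable
  have hgm := fun n => (g n).aemeasurable_integral hW
  have hprod : ∀ n, charFun (P.map (N + (g n).integral W)) t =
      charFun (P.map N) t * charFun (P.map ((g n).integral W)) t := by
    intro n
    have hmeas : Measurable fun w : ℝ≥0 → ℝ => ∑ i, ∑ j, (g n).coeff i j
        * (w ((g n).time i.succ) - w ((g n).time i.castSucc))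
        * (w ((g n).time j.succ) - w ((g n).time j.castSucc)) :=
      Finset.measurable_sum _ fun i _ => Finset.measurable_sum _ fun j _ => by fun_prop
    have hind : IndepFun N ((g n).integral W) P := hindep.comp measurable_id hmeas
    rw [hind.charFun_map_add_eq_mul hN (hgm n), Pi.mul_apply]
  have h1 := tendsto_charFun_of_tendsto_eLpNorm (X := fun n => N + (g n).integral W)
    (fun n => hN.add (hgm n)) (hN.add hFm) (by simpa using hg) t
  simp_rw [hprod] at h1
  exact tendsto_nhds_unique h1 ((tendsto_charFun_of_tendsto_eLpNorm hgm hFm hg t).const_mul _)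

end DoubleIntegral

/-! ### Stability of traces of powers in the Hilbert-Schmidt norm -/

section Frobenius

open Matrix
open scoped Matrix.Norms.Frobenius

variable {n : Type*} [Fintype n] [DecidableEq n]

lemma sq_frobenius_norm (A : Matrix n n ℝ) : ‖A‖ ^ 2 = ∑ i, ∑ j, A i j ^ 2 := by
  rw [frobenius_norm_def, ← Real.sqrt_eq_rpow, Real.sq_sqrt (by positivity)]
  simp

lemma abs_trace_mul_le (A B : Matrix n n ℝ) : |(A * B).trace| ≤ ‖A‖ * ‖B‖ := by
  refine abs_le_of_sq_le_sq ?_ (by positivity)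
  rw [mul_pow, ← frobenius_norm_transpose B, sq_frobenius_norm, sq_frobenius_norm,
    ← Fintype.sum_prod_type' (f := fun i j => A i j ^ 2),
    ← Fintype.sum_prod_type' (f := fun i j => Bᵀ i j ^ 2)]
  have h : (A * B).trace = ∑ p : n × n, A p.1 p.2 * Bᵀ p.1 p.2 := by
    rw [Fintype.sum_prod_type]; rfl
  rw [h]
  exact Finset.sum_mul_sq_le_sq_mul_sq _ _ _

lemma norm_pow_succ_sub_pow_succ_le {A B : Matrix n n ℝ} {M : ℝ} (hA : ‖A‖ ≤ M) (hB : ‖B‖ ≤ M)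
    (r : ℕ) : ‖A ^ (r + 1) - B ^ (r + 1)‖ ≤ (r + 1) * M ^ r * ‖A - B‖ := by
  have hM : 0 ≤ M := (norm_nonneg _).trans hA
  induction r with
  | zero => simp
  | succ r ih =>
    have h : A ^ (r + 1 + 1) - B ^ (r + 1 + 1) =
        (A ^ (r + 1) - B ^ (r + 1)) * A + B ^ (r + 1) * (A - B) := by
      rw [pow_succ A, pow_succ B (r + 1)]; noncomm_ring
    have hBp : ‖B ^ (r + 1)‖ ≤ M ^ (r + 1) :=
      (norm_pow_le' B r.succ_pos).trans (by gcongr)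
    rw [h]
    calc _ ≤ ‖A ^ (r + 1) - B ^ (r + 1)‖ * ‖A‖ + ‖B ^ (r + 1)‖ * ‖A - B‖ :=
          (norm_add_le _ _).trans (add_le_add (norm_mul_le _ _) (norm_mul_le _ _))
      _ ≤ ((r + 1) * M ^ r * ‖A - B‖) * M + M ^ (r + 1) * ‖A - B‖ := by gcongr
      _ = _ := by push_cast; ring

lemma abs_trace_pow_sub_trace_pow_le {A B : Matrix n n ℝ} {M : ℝ} (hA : ‖A‖ ≤ M) (hB : ‖B‖ ≤ M)
    (r : ℕ) : |(A ^ (r + 2)).trace - (B ^ (r + 2)).trace| ≤ (r + 2) * M ^ (r + 1) * ‖A - B‖ := by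
  have hM : 0 ≤ M := (norm_nonneg _).trans hA
  have h : (A ^ (r + 2)).trace - (B ^ (r + 2)).trace =
      ((A ^ (r + 1) - B ^ (r + 1)) * A).trace + (B ^ (r + 1) * (A - B)).trace := by
    rw [← trace_sub, ← trace_add, pow_succ A, pow_succ B (r + 1)]
    congr 1
    noncomm_ring
  have hBp : ‖B ^ (r + 1)‖ ≤ M ^ (r + 1) :=
    (norm_pow_le' B r.succ_pos).trans (by gcongr)
  rw [h]
  calc _ ≤ ‖A ^ (r + 1) - B ^ (r + 1)‖ * ‖A‖ + ‖B ^ (r + 1)‖ * ‖A - B‖ :=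
        (abs_add_le _ _).trans (add_le_add (abs_trace_mul_le _ _) (abs_trace_mul_le _ _))
    _ ≤ ((r + 1) * M ^ r * ‖A - B‖) * M + M ^ (r + 1) * ‖A - B‖ := by
        gcongr; exact norm_pow_succ_sub_pow_succ_le hA hB r
    _ = _ := by ring

end Frobenius

/-! ### Tensor products of functions and kernels -/

lemma memLp_tensor (u v : L2Half) :
    MemLp (fun p : ℝ × ℝ => u p.1 * v p.2) 2 (halfLine.prod halfLine) := by
  have hu := Lp.memLp u
  have hv := Lp.memLp v
  refine (memLp_two_iff_integrable_sq
    (hu.aestronglyMeasurable.comp_fst.mul hv.aestronglyMeasurable.comp_snd)).2 ?_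
  refine (hu.integrable_sq.mul_prod hv.integrable_sq).congr (.of_forall fun p => ?_)
  simp only [Pi.mul_apply, mul_pow]

/-- The kernel `(x, y) ↦ u(x) v(y)`. -/
def tensor (u v : L2Half) : L2Quadrant := (memLp_tensor u v).toLp

lemma coeFn_tensor (u v : L2Half) :
    tensor u v =ᵐ[halfLine.prod halfLine] fun p => u p.1 * v p.2 := MemLp.coeFn_toLp _

lemma inner_tensor (u v : L2Half) (f : L2Quadrant) :
    inner ℝ (tensor u v) f = inner ℝ u (kernelOperator f v) := by
  have h1 : inner ℝ (tensor u v) f = ∫ p, u p.1 * (f p * v p.2) ∂(halfLine.prod halfLine) := by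
    rw [L2.inner_def]
    refine integral_congr_ae ?_
    filter_upwards [coeFn_tensor u v] with p hp
    rw [hp]; simp; ring
  have hint : Integrable (fun p => u p.1 * (f p * v p.2)) (halfLine.prod halfLine) := by
    refine ((memLp_tensor u v).integrable_mul (Lp.memLp f)).congr (.of_forall fun p => ?_)
    simp only [Pi.mul_apply]; ring
  rw [h1, integral_prod _ hint, L2.inner_def]
  refine integral_congr_ae ?_
  filter_upwards [(memLp_integral f v).coeFn_toLp] with x hx
  have : kernelOperator f v x = ∫ y, f (x, y) * v y ∂halfLine := hx
  rw [this, integral_const_mul]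
  simp [mul_comm]

lemma inner_tensor_tensor (u v u' v' : L2Half) :
    inner ℝ (tensor u v) (tensor u' v') = inner ℝ u u' * inner ℝ v v' := by
  rw [L2.inner_def, L2.inner_def, L2.inner_def, ← integral_prod_mul]
  refine integral_congr_ae ?_
  filter_upwards [coeFn_tensor u v, coeFn_tensor u' v'] with p hp hp'
  rw [hp, hp']; simp; ring

lemma inner_tensor_swap {f : L2Quadrant} (hf : IsSymmetricKernel f) (u v : L2Half) :
    inner ℝ (tensor u v) f = inner ℝ (tensor v u) f := by
  rw [L2.inner_def, L2.inner_def, ← integral_prod_swap]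
  refine integral_congr_ae ?_
  have hq : Measure.QuasiMeasurePreserving Prod.swap (halfLine.prod halfLine)
      (halfLine.prod halfLine) := Measure.measurePreserving_swap.quasiMeasurePreserving
  filter_upwards [hf, coeFn_tensor v u, hq.ae (coeFn_tensor u v)] with p hp h1 h2
  rw [hp, h1, h2]
  simp only [RCLike.inner_apply, conj_trivial, Prod.fst_swap, Prod.snd_swap]
  ring

lemma kernelOperator_isSymmetric {f : L2Quadrant} (hf : IsSymmetricKernel f) :
    (kernelOperator f).IsSymmetric := fun u v => by
  rw [real_inner_comm, ← inner_tensor, inner_tensor_swap hf, inner_tensor]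

/-- `f` acts on tensor products as `∑ i, ∑ j, c i j u i ⊗ u j`. -/
def IsTensorSum {ι : Type*} [Fintype ι] (f : L2Quadrant) (c : Matrix ι ι ℝ) (u : ι → L2Half) :
    Prop :=
  ∀ x y, inner ℝ (tensor x y) f = ∑ i, ∑ j, c i j * (inner ℝ x (u i) * inner ℝ y (u j))

section Compression

open Matrix
open scoped Matrix.Norms.Frobenius

variable {d : ℕ} {V : Submodule ℝ L2Half} (w : OrthonormalBasis (Fin d) ℝ V)

/-- The matrix of the compression of `T_f` to a finite-dimensional space. -/
def compression (f : L2Quadrant) : Matrix (Fin d) (Fin d) ℝ :=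
  of fun k l => inner ℝ (tensor (w k) (w l)) f

/-- Bessel's inequality for the orthonormal family of the `w k ⊗ w l`. -/
lemma norm_compression_le (f : L2Quadrant) : ‖compression w f‖ ≤ ‖f‖ := by
  refine (sq_le_sq₀ (norm_nonneg _) (norm_nonneg _)).1 ?_
  have hw : Orthonormal ℝ fun k => (w k : L2Half) :=
    w.orthonormal.comp_linearIsometry V.subtypeₗᵢ
  have horth : Orthonormal ℝ fun p : Fin d × Fin d => tensor (w p.1) (w p.2) := by
    rw [orthonormal_iff_ite] at hw ⊢
    intro p q
    rw [inner_tensor_tensor, hw, hw]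
    by_cases h1 : p.1 = q.1 <;> by_cases h2 : p.2 = q.2 <;> simp [h1, h2, Prod.ext_iff]
  have h := horth.sum_inner_products_le f (s := Finset.univ)
  rw [sq_frobenius_norm]
  rw [Fintype.sum_prod_type] at h
  simpa [compression] using h

lemma compression_sub (f g : L2Quadrant) :
    compression w (f - g) = compression w f - compression w g := by
  ext k l; simp [compression, inner_sub_right]

lemma trace_compression_pow {ι : Type*} [Fintype ι] [DecidableEq ι] {f : L2Quadrant}
    {c : Matrix ι ι ℝ} {u : ι → L2Half} (hf : IsTensorSum f c u) (hu : ∀ i, u i ∈ V) (r : ℕ) :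
    (compression w f ^ (r + 1)).trace =
      ((c * of fun i j => inner ℝ (u i) (u j)) ^ (r + 1)).trace := by
  set U : Matrix (Fin d) ι ℝ := of fun k i => inner ℝ (w k : L2Half) (u i) with hU
  have h1 : compression w f = U * (c * Uᵀ) := by
    ext k l
    rw [compression, of_apply, hf]
    simp only [mul_apply, transpose_apply, hU, of_apply, Finset.mul_sum]
    exact Finset.sum_congr rfl fun i _ => Finset.sum_congr rfl fun j _ => by ring
  have h2 : Uᵀ * U = of fun i j => inner ℝ (u i) (u j) := by
    ext i j
    have := w.sum_inner_mul_inner ⟨u i, hu i⟩ ⟨u j, hu j⟩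
    simp only [Submodule.coe_inner] at this
    simpa [mul_apply, hU, real_inner_comm] using this
  rw [h1, trace_mul_pow_succ_comm, Matrix.mul_assoc, h2]

end Compression

/-- Traces of powers are continuous on kernels of finite rank, for the norm of `L²`: two such
kernels are compared on a finite-dimensional space that contains all the functions involved. -/
lemma abs_trace_pow_sub_trace_pow_le_of_isTensorSum {ι κ : Type*} [Fintype ι] [DecidableEq ι]
    [Fintype κ] [DecidableEq κ] {f g : L2Quadrant} {c : Matrix ι ι ℝ} {u : ι → L2Half}
    (hf : IsTensorSum f c u) {c' : Matrix κ κ ℝ} {u' : κ → L2Half} (hg : IsTensorSum g c' u')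
    {M : ℝ} (hfM : ‖f‖ ≤ M) (hgM : ‖g‖ ≤ M) (r : ℕ) :
    |((c * Matrix.of fun i j => inner ℝ (u i) (u j)) ^ (r + 2)).trace -
      ((c' * Matrix.of fun i j => inner ℝ (u' i) (u' j)) ^ (r + 2)).trace| ≤
      (r + 2) * M ^ (r + 1) * ‖f - g‖ := by
  set V : Submodule ℝ L2Half := Submodule.span ℝ (Set.range u ∪ Set.range u')
  have : FiniteDimensional ℝ V :=
    FiniteDimensional.span_of_finite ℝ ((Set.finite_range u).union (Set.finite_range u'))
  set w := stdOrthonormalBasis ℝ V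
  have hu : ∀ i, u i ∈ V := fun i => Submodule.subset_span (.inl ⟨i, rfl⟩)
  have hu' : ∀ i, u' i ∈ V := fun i => Submodule.subset_span (.inr ⟨i, rfl⟩)
  rw [← trace_compression_pow w hf hu, ← trace_compression_pow w hg hu']
  refine (abs_trace_pow_sub_trace_pow_le ((norm_compression_le w f).trans hfM)
    ((norm_compression_le w g).trans hgM) r).trans ?_
  have hM : 0 ≤ M := (norm_nonneg _).trans hfM
  gcongr
  rw [← compression_sub]
  exact norm_compression_le w _

/-! ### Step kernels as elements of `L²` -/

namespace StepKernel

variable (g : StepKernel)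

lemma halfLine_Ioc (i : Fin g.size) :
    halfLine (Set.Ioc (g.time i.castSucc : ℝ) (g.time i.succ)) = ENNReal.ofReal (g.length i) := by
  rw [Measure.restrict_apply measurableSet_Ioc, Set.inter_eq_left.2, Real.volume_Ioc, length]
  exact fun x hx => (NNReal.coe_nonneg _).trans hx.1.le

/-- The indicator function of the `i`-th interval of the subdivision. -/
def intervalIndicator (i : Fin g.size) : L2Half :=
  indicatorConstLp 2 (measurableSet_Ioc (a := (g.time i.castSucc : ℝ)) (b := g.time i.succ))
    (by rw [halfLine_Ioc]; exact ENNReal.ofReal_ne_top) 1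

lemma coeFn_intervalIndicator (i : Fin g.size) : g.intervalIndicator i =ᵐ[halfLine]
    (Set.Ioc (g.time i.castSucc : ℝ) (g.time i.succ)).indicator 1 := indicatorConstLp_coeFn

lemma inner_intervalIndicator (i j : Fin g.size) :
    inner ℝ (g.intervalIndicator i) (g.intervalIndicator j) =
      Matrix.diagonal g.length i j := by
  rw [intervalIndicator, L2.inner_indicatorConstLp_one]
  rw [setIntegral_congr_ae (g := (Set.Ioc (g.time j.castSucc : ℝ) (g.time j.succ)).indicator 1)
    measurableSet_Ioc ((g.coeFn_intervalIndicator j).mono fun x hx _ => hx)]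
  rw [integral_indicator_one measurableSet_Ioc, measureReal_def,
    Measure.restrict_apply measurableSet_Ioc]
  by_cases hij : i = j
  · subst hij
    rw [Set.inter_self, halfLine_Ioc, Matrix.diagonal_apply_eq,
      ENNReal.toReal_ofReal (g.length_nonneg i)]
  · rw [Matrix.diagonal_apply_ne _ hij]
    have hdisj : Disjoint (Set.Ioc (g.time j.castSucc : ℝ) (g.time j.succ))
        (Set.Ioc (g.time i.castSucc : ℝ) (g.time i.succ)) := by
      rw [Set.Ioc_disjoint_Ioc]
      rcases lt_or_gt_of_ne hij with h | h
      · have : (g.time i.succ : ℝ) ≤ g.time j.castSucc := by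
          exact_mod_cast g.time_mono (Fin.succ_le_castSucc_iff.2 h)
        exact (min_le_right _ _).trans (this.trans (le_max_left _ _))
      · have : (g.time j.succ : ℝ) ≤ g.time i.castSucc := by
          exact_mod_cast g.time_mono (Fin.succ_le_castSucc_iff.2 h)
        exact (min_le_left _ _).trans (this.trans (le_max_right _ _))
    rw [hdisj.inter_eq, measure_empty, ENNReal.toReal_zero]

/-- The step kernel as an element of `L²`. -/
def toL2 : L2Quadrant :=
  ∑ i, ∑ j, g.coeff i j • tensor (g.intervalIndicator i) (g.intervalIndicator j)

lemma coeFn_toL2 : g.toL2 =ᵐ[halfLine.prod halfLine] g.toFun := by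
  have h1 : ∀ i j, (g.coeff i j • tensor (g.intervalIndicator i) (g.intervalIndicator j) :
      L2Quadrant) =ᵐ[halfLine.prod halfLine] fun p => g.coeff i j
        * (Set.Ioc (g.time i.castSucc : ℝ) (g.time i.succ)).indicator 1 p.1
        * (Set.Ioc (g.time j.castSucc : ℝ) (g.time j.succ)).indicator 1 p.2 := by
    intro i j
    filter_upwards [Lp.coeFn_smul (g.coeff i j)
      (tensor (g.intervalIndicator i) (g.intervalIndicator j)), coeFn_tensor _ _,
      Measure.quasiMeasurePreserving_fst.ae (g.coeFn_intervalIndicator i),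
      Measure.quasiMeasurePreserving_snd.ae (g.coeFn_intervalIndicator j)] with p h1 h2 h3 h4
    rw [h1, Pi.smul_apply, h2, h3, h4, smul_eq_mul, mul_assoc]
  have h2 : ∀ i, (∑ j, g.coeff i j • tensor (g.intervalIndicator i) (g.intervalIndicator j) :
      L2Quadrant) =ᵐ[halfLine.prod halfLine] fun p => ∑ j, g.coeff i j
        * (Set.Ioc (g.time i.castSucc : ℝ) (g.time i.succ)).indicator 1 p.1
        * (Set.Ioc (g.time j.castSucc : ℝ) (g.time j.succ)).indicator 1 p.2 := by
    intro i
    filter_upwards [Lp.coeFn_finsetSum Finset.univ fun j =>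
      g.coeff i j • tensor (g.intervalIndicator i) (g.intervalIndicator j),
      ae_all_iff.2 (h1 i)] with p h3 h4
    rw [h3, Finset.sum_apply]
    exact Finset.sum_congr rfl fun j _ => h4 j
  filter_upwards [Lp.coeFn_finsetSum Finset.univ fun i =>
    ∑ j, g.coeff i j • tensor (g.intervalIndicator i) (g.intervalIndicator j),
    ae_all_iff.2 h2] with p h3 h4
  rw [toL2, h3, Finset.sum_apply]
  exact Finset.sum_congr rfl fun i _ => h4 i

lemma enorm_toL2_sub (f : L2Quadrant) :
    ‖g.toL2 - f‖ₑ = eLpNorm (fun p => g.toFun p - f p) 2 (halfLine.prod halfLine) := by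
  rw [Lp.enorm_def]
  refine eLpNorm_congr_ae ?_
  filter_upwards [Lp.coeFn_sub g.toL2 f, g.coeFn_toL2] with p h1 h2
  rw [h1, Pi.sub_apply, h2]

lemma isTensorSum_toL2 : IsTensorSum g.toL2 g.coeff g.intervalIndicator := by
  intro x y
  simp only [toL2, inner_sum, inner_smul_right, inner_tensor_tensor]

lemma of_inner_intervalIndicator :
    (Matrix.of fun i j => inner ℝ (g.intervalIndicator i) (g.intervalIndicator j)) =
      Matrix.diagonal g.length := by
  ext i j
  rw [Matrix.of_apply, inner_intervalIndicator]

lemma sq_norm_toL2 : ‖g.toL2‖ ^ 2 = powerSum g.eigenvalues 2 := by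
  have h : ∀ F : L2Quadrant, inner ℝ g.toL2 F = ∑ i, ∑ j,
      g.coeff i j * inner ℝ (tensor (g.intervalIndicator i) (g.intervalIndicator j)) F := by
    intro F
    simp only [toL2, sum_inner, inner_smul_left, conj_trivial]
  rw [g.powerSum_eigenvalues 1, ← real_inner_self_eq_norm_sq, h]
  simp_rw [g.isTensorSum_toL2 _ _, inner_intervalIndicator, Matrix.diagonal_apply]
  have htr : ((g.coeff * Matrix.diagonal g.length) ^ (1 + 1)).trace =
      ∑ i, ∑ j, g.coeff i j * g.length j * (g.coeff j i * g.length i) := by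
    rw [pow_succ, pow_one, Matrix.trace]
    refine Finset.sum_congr rfl fun i _ => ?_
    rw [Matrix.diag_apply, Matrix.mul_apply]
    simp_rw [Matrix.mul_diagonal]
  rw [htr]
  refine Finset.sum_congr rfl fun i _ => Finset.sum_congr rfl fun j _ => ?_
  rw [Finset.sum_eq_single i, Finset.sum_eq_single j]
  · rw [if_pos rfl, if_pos rfl, g.coeff_symm.apply]; ring
  · intro b _ hb; simp [hb.symm]
  · simp
  · intro b _ hb; simp [hb.symm]
  · simp

end StepKernel

/-! ### Spectral decomposition of symmetric kernels of finite rank -/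

/-- The eigenvalues, with multiplicity, of `T_f` on its range. -/
lemma exists_eigenvalues {f : L2Quadrant} (hf : IsSymmetricKernel f) (hr : HasFiniteRank f) :
    ∃ (L : Fin (rank f) → ℝ) (e : Fin (rank f) → L2Half), Orthonormal ℝ e ∧
      IsTensorSum f (Matrix.diagonal L) e ∧ (∀ j, L j ≠ 0) ∧
      ∀ x, x ∈ nonzeroEigenvalues f ↔ ∃ j, L j = x := by
  set T := kernelOperator f with hT
  have hsymm : T.IsSymmetric := kernelOperator_isSymmetric hf
  have hfin : FiniteDimensional ℝ (LinearMap.range T) := hr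
  have hinv : ∀ v ∈ LinearMap.range T, T v ∈ LinearMap.range T := fun v _ => ⟨v, rfl⟩
  have hS := hsymm.restrict_invariant hinv
  set b := hS.eigenvectorBasis (n := rank f) rfl
  set L := hS.eigenvalues (n := rank f) rfl
  set e : Fin (rank f) → L2Half := fun j => (b j : L2Half) with he
  have heT : ∀ j, T (e j) = L j • e j := fun j => by
    have := congrArg Subtype.val (hS.apply_eigenvectorBasis (n := rank f) rfl j)
    simpa using this
  have horth : Orthonormal ℝ e := b.orthonormal.comp_linearIsometry (LinearMap.range T).subtypeₗᵢ
  have hexp : ∀ y ∈ LinearMap.range T, y = ∑ j, inner ℝ (e j) y • e j := by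
    intro y hy
    have := congrArg Subtype.val (b.sum_repr' ⟨y, hy⟩)
    simpa [he] using this.symm
  have hTx : ∀ x, T x = ∑ j, (L j * inner ℝ (e j) x) • e j := by
    intro x
    rw [hexp (T x) ⟨x, rfl⟩]
    refine Finset.sum_congr rfl fun j _ => ?_
    rw [← hsymm, heT, inner_smul_left, conj_trivial]
  have hL : ∀ j, L j ≠ 0 := by
    intro j hj
    obtain ⟨y, hy⟩ := (b j).2
    have h1 : inner ℝ (e j) (e j) = (0 : ℝ) := by
      conv_lhs => rw [show e j = T y from hy.symm]
      rw [hsymm, show T y = e j from hy, heT, hj, zero_smul, inner_zero_right]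
    exact horth.ne_zero j (inner_self_eq_zero.1 h1)
  refine ⟨L, e, horth, fun x y => ?_, hL, fun x => ⟨fun hx => ?_, ?_⟩⟩
  · rw [inner_tensor, ← hT, hTx, inner_sum]
    refine Finset.sum_congr rfl fun j _ => ?_
    rw [Finset.sum_eq_single j (fun i _ hi => by simp [hi.symm]) (by simp),
      Matrix.diagonal_apply_eq, inner_smul_right, real_inner_comm y]
    ring
  · obtain ⟨hx0, hxe⟩ := hx
    obtain ⟨h, hh⟩ := hxe.exists_hasEigenvector
    have hTh : T h = x • h := hh.apply_eq_smul
    by_contra hne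
    push Not at hne
    have hz : ∀ j, inner ℝ (e j) h = (0 : ℝ) := by
      intro j
      have h1 : inner ℝ (T (e j)) h = inner ℝ (e j) (T h) := hsymm _ _
      rw [heT, hTh, inner_smul_left, inner_smul_right, conj_trivial] at h1
      have h2 : (L j - x) * inner ℝ (e j) h = 0 := by linarith
      exact (mul_eq_zero.1 h2).resolve_left (sub_ne_zero.2 (hne j))
    have h3 : x • h = 0 := by rw [← hTh, hTx]; simp [hz]
    exact hh.2 ((smul_eq_zero.1 h3).resolve_left hx0)
  · rintro ⟨j, rfl⟩
    exact ⟨hL j, Module.End.hasEigenvalue_of_hasEigenvector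
      ⟨Module.End.mem_eigenspace_iff.2 (heT j), horth.ne_zero j⟩⟩

/-- If step kernels converge to `f` in `L²`, then the power sums of their eigenvalues converge to
those of the eigenvalues of `f`. -/
lemma tendsto_powerSum_eigenvalues {f : L2Quadrant} {k : ℕ} {L : Fin k → ℝ} {e : Fin k → L2Half}
    (he : Orthonormal ℝ e) (hf : IsTensorSum f (Matrix.diagonal L) e) {g : ℕ → StepKernel}
    (hg : Tendsto (fun n => eLpNorm (fun p => (g n).toFun p - f p) 2 (halfLine.prod halfLine))
      atTop (𝓝 0)) {r : ℕ} (hr : 2 ≤ r) :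
    Tendsto (fun n => powerSum (g n).eigenvalues r) atTop (𝓝 (powerSum L r)) := by
  obtain ⟨r, rfl⟩ := Nat.exists_eq_add_of_le' hr
  have hlim : Tendsto (fun n => (g n).toL2) atTop (𝓝 f) := by
    rw [tendsto_iff_edist_tendsto_0]
    simpa only [edist_eq_enorm_sub, StepKernel.enorm_toL2_sub] using hg
  obtain ⟨C, hC⟩ := hlim.norm.bddAbove_range
  have hCn : ∀ n, ‖(g n).toL2‖ ≤ C := fun n => hC ⟨n, rfl⟩
  have hgram : (Matrix.of fun i j => inner ℝ (e i) (e j)) = (1 : Matrix (Fin k) (Fin k) ℝ) := by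
    ext i j
    rw [Matrix.of_apply, orthonormal_iff_ite.1 he, Matrix.one_apply]
  rw [tendsto_iff_norm_sub_tendsto_zero]
  have hz : Tendsto (fun n => (r + 2) * max C ‖f‖ ^ (r + 1) * ‖(g n).toL2 - f‖) atTop (𝓝 0) := by
    simpa using (tendsto_iff_norm_sub_tendsto_zero.1 hlim).const_mul
      ((r + 2) * max C ‖f‖ ^ (r + 1))
  refine squeeze_zero (fun _ => norm_nonneg _) (fun n => ?_) hz
  have h := abs_trace_pow_sub_trace_pow_le_of_isTensorSum (g n).isTensorSum_toL2 hf
    ((hCn n).trans (le_max_left _ _)) (le_max_right C ‖f‖) r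
  rwa [StepKernel.of_inner_intervalIndicator, hgram, Matrix.mul_one, trace_diagonal_pow,
    ← StepKernel.powerSum_eigenvalues] at h

lemma sq_norm_eq_powerSum {f : L2Quadrant} {k : ℕ} {L : Fin k → ℝ} {e : Fin k → L2Half}
    (he : Orthonormal ℝ e) (hf : IsTensorSum f (Matrix.diagonal L) e) {g : ℕ → StepKernel}
    (hg : Tendsto (fun n => eLpNorm (fun p => (g n).toFun p - f p) 2 (halfLine.prod halfLine))
      atTop (𝓝 0)) : ‖f‖ ^ 2 = powerSum L 2 := by
  have hlim : Tendsto (fun n => (g n).toL2) atTop (𝓝 f) := by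
    rw [tendsto_iff_edist_tendsto_0]
    simpa only [edist_eq_enorm_sub, StepKernel.enorm_toL2_sub] using hg
  refine tendsto_nhds_unique (hlim.norm.pow 2) ?_
  simp_rw [StepKernel.sq_norm_toL2]
  exact tendsto_powerSum_eigenvalues he hf hg le_rfl

/-! ### The criterion for convergence in law -/

lemma cumulant_eq_iteratedDeriv_cgf_map {Ω : Type*} [MeasurableSpace Ω] {P : Measure Ω}
    {X : Ω → ℝ} (hX : AEMeasurable X P) (r : ℕ) :
    cumulant r X P = iteratedDeriv r (cgf id (P.map X)) 0 := by
  have h : cgf X P = cgf id (P.map X) := by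
    ext t; rw [cgf, cgf, mgf_id_map hX]
  rw [cumulant, h]

section Criterion

variable {Ω : Type*} [MeasurableSpace Ω] {P : Measure Ω} [IsProbabilityMeasure P]
  {Ω' : Type*} [MeasurableSpace Ω'] {P' : Measure Ω'} [IsProbabilityMeasure P']

lemma tendstoInDistribution_iff_tendsto_charFun {F : ℕ → Ω → ℝ} {X : Ω' → ℝ}
    (hF : ∀ n, AEMeasurable (F n) P) (hX : AEMeasurable X P') :
    TendstoInDistribution F atTop X (fun _ => P) P' ↔
      ∀ t, Tendsto (fun n => charFun (P.map (F n)) t) atTop (𝓝 (charFun (P'.map X) t)) :=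
  ⟨fun h t => ProbabilityMeasure.tendsto_iff_tendsto_charFun.1 h.tendsto t,
    fun h => ⟨hF, hX, ProbabilityMeasure.tendsto_iff_tendsto_charFun.2 h⟩⟩

lemma tendsto_iff_of_tendsto_sub {E : Type*} [SeminormedAddCommGroup E] {x y : ℕ → E} {c : E}
    (h : Tendsto (fun n => x n - y n) atTop (𝓝 0)) :
    Tendsto x atTop (𝓝 c) ↔ Tendsto y atTop (𝓝 c) :=
  ⟨fun hx => by simpa using hx.sub h, fun hy => by simpa using h.add hy⟩

/-- The criterion, with the limit described by its characteristic function and the conditions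
expressed in terms of the power sums of the weights `L`. -/
theorem tendstoInDistribution_iff_of_charFun_eq {F : ℕ → Ω → ℝ} (hFm : ∀ n, AEMeasurable (F n) P)
    (hF : ∀ n, IsChaosLimit (P.map (F n))) {X : Ω' → ℝ} (hX : AEMeasurable X P')
    {k : ℕ} {L : Fin k → ℝ} {v : ℝ} (hv : 0 ≤ v)
    (hchar : ∀ t : ℝ, charFun (P'.map X) t =
      Complex.exp (∑ j, squareCgf (t * Complex.I * L j) - t ^ 2 * v))
    {E : Finset ℝ} {d s : ℕ} (hE : ∀ x, x ∈ E ↔ ∃ j, L j = x) (h0 : (0 : ℝ) ∉ E)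
    (hd : d = 0 ∧ v = 0 ∨ d = 1) (hs : 2 * (1 + d) ≤ s) {Q : Polynomial ℝ}
    (hQ : Q = Polynomial.X ^ (2 * (1 + d)) * ∏ x ∈ E, (Polynomial.X - Polynomial.C x) ^ 2) :
    TendstoInDistribution F atTop X (fun _ => P) P' ↔
      Tendsto (fun n => cumulant 2 (F n) P) atTop (𝓝 (2 * (powerSum L 2 + v))) ∧
      Tendsto (fun n => ∑ r ∈ Finset.Icc 3 Q.natDegree,
          Q.coeff r * (cumulant r (F n) P / (((r - 1).factorial : ℝ) * 2 ^ (r - 1)))) atTop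
        (𝓝 (∑ r ∈ Finset.Icc 3 Q.natDegree, Q.coeff r * powerSum L r)) ∧
      ∀ r ∈ Finset.Ico s (s + E.card), Tendsto (fun n => cumulant r (F n) P) atTop
        (𝓝 (2 ^ (r - 1) * (r - 1).factorial * powerSum L r)) := by
  have hprob : ∀ n, IsProbabilityMeasure (P.map (F n)) :=
    fun n => Measure.isProbabilityMeasure_map (hFm n)
  have hprobX : IsProbabilityMeasure (P'.map X) := Measure.isProbabilityMeasure_map hX
  obtain ⟨m, l, hl, hκ⟩ := exists_chaosLaw_seq hF
  have hsub : ∀ r, 2 ≤ r → Tendsto (fun n => cumulant r (F n) P -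
      2 ^ (r - 1) * (r - 1).factorial * powerSum (l n) r) atTop (𝓝 0) := by
    intro r hr
    simpa [cumulant_eq_iteratedDeriv_cgf_map (hFm _), factorial_mul_chaosCoeff _ hr]
      using (hκ r).neg
  have hpos : ∀ r : ℕ, (2 : ℝ) ^ (r - 1) * (r - 1).factorial ≠ 0 := fun r => by positivity
  have hcum : ∀ r, 2 ≤ r → ∀ c, Tendsto (fun n => cumulant r (F n) P) atTop
      (𝓝 (2 ^ (r - 1) * (r - 1).factorial * c)) ↔
        Tendsto (fun n => powerSum (l n) r) atTop (𝓝 c) := by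
    intro r hr c
    rw [tendsto_iff_of_tendsto_sub (hsub r hr)]
    refine ⟨fun h => ?_, fun h => h.const_mul _⟩
    have h1 := h.const_mul ((2 : ℝ) ^ (r - 1) * (r - 1).factorial)⁻¹
    simp_rw [inv_mul_cancel_left₀ (hpos r)] at h1
    exact h1
  have htest : ∀ c, Tendsto (fun n => ∑ r ∈ Finset.Icc 3 Q.natDegree,
      Q.coeff r * (cumulant r (F n) P / (((r - 1).factorial : ℝ) * 2 ^ (r - 1)))) atTop (𝓝 c) ↔
      Tendsto (fun n => ∑ r ∈ Finset.Icc 3 Q.natDegree, Q.coeff r * powerSum (l n) r) atTop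
        (𝓝 c) := by
    intro c
    refine tendsto_iff_of_tendsto_sub ?_
    simp_rw [← Finset.sum_sub_distrib, ← mul_sub]
    have : Tendsto (fun n => ∑ r ∈ Finset.Icc 3 Q.natDegree, Q.coeff r *
        (cumulant r (F n) P / (((r - 1).factorial : ℝ) * 2 ^ (r - 1)) - powerSum (l n) r)) atTop
        (𝓝 (∑ r ∈ Finset.Icc 3 Q.natDegree, Q.coeff r * 0)) := by
      refine tendsto_finsetSum _ fun r hr => Tendsto.const_mul _ ?_
      have h1 := (hsub r (by rw [Finset.mem_Icc] at hr; omega)).const_mul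
        ((2 : ℝ) ^ (r - 1) * (r - 1).factorial)⁻¹
      rw [mul_zero] at h1
      refine h1.congr fun n => ?_
      have := hpos r
      rw [mul_sub, inv_mul_cancel_left₀ this, mul_comm (2 ^ (r - 1) : ℝ)]
      ring
    simpa using this
  have hdist : TendstoInDistribution F atTop X (fun _ => P) P' ↔
      ∀ r, 2 ≤ r → Tendsto (fun n => powerSum (l n) r) atTop
        (𝓝 (powerSum L r + if r = 2 then v else 0)) := by
    rw [tendstoInDistribution_iff_tendsto_charFun hFm hX]
    refine ⟨fun h r hr => ?_, fun h t => ?_⟩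
    · have h1 := tendsto_cumulant_of_tendsto_charFun (μ := P'.map X)
        (fun t => (tendsto_iff_of_tendsto_sub (hl t)).2 (h t)) r
      simp_rw [factorial_mul_chaosCoeff _ hr] at h1
      rw [cumulant_of_charFun_eq hv hchar hr] at h1
      have h2 := h1.const_mul ((2 : ℝ) ^ (r - 1) * (r - 1).factorial)⁻¹
      simp_rw [inv_mul_cancel_left₀ (hpos r)] at h2
      exact h2
    · rw [← tendsto_iff_of_tendsto_sub (hl t), hchar]
      exact tendsto_charFun_chaosLaw h t
  have h2 : (2 : ℝ) * (powerSum L 2 + v) =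
      2 ^ (2 - 1) * (2 - 1).factorial * (powerSum L 2 + v) := by norm_num
  rw [hdist, htest, h2, hcum 2 le_rfl]
  constructor
  · intro h
    refine ⟨by simpa using h 2 le_rfl, ?_, fun r hr => ?_⟩
    · refine tendsto_finsetSum _ fun r hr => Tendsto.const_mul _ ?_
      have hr3 : 3 ≤ r := (Finset.mem_Icc.1 hr).1
      simpa [show r ≠ 2 by omega] using h r (by omega)
    · have hr2 : s ≤ r := (Finset.mem_Ico.1 hr).1
      rw [hcum r (by omega)]
      have h3 := h r (by omega)
      rcases hd with ⟨_, rfl⟩ | hd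
      · simpa using h3
      · simpa [show r ≠ 2 by omega] using h3
  · rintro ⟨ha, hb, hc⟩ r hr
    refine tendsto_powerSum_of_tendsto_testPolynomial hE h0 hd hs hQ ha hb (fun r hr => ?_) hr
    have hr2 : s ≤ r := (Finset.mem_Ico.1 hr).1
    exact (hcum r (by omega) _).1 (hc r hr)

end Criterion

lemma taylorCoeff_eq_coeff (Q : Polynomial ℝ) (r : ℕ) : taylorCoeff Q r = Q.coeff r := by
  have h : (r.factorial : ℝ) ≠ 0 := by positivity
  rw [taylorCoeff, ← Polynomial.coeff_zero_eq_eval_zero, Polynomial.coeff_iterate_derivative,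
    zero_add, Nat.descFactorial_self, nsmul_eq_mul, mul_div_cancel_left₀ _ h]

lemma testPolynomial_eq {μ₀ : ℝ} {f : L2Quadrant} {E : Finset ℝ}
    (hE : nonzeroEigenvalues f = E) : testPolynomial μ₀ f =
      Polynomial.X ^ (2 * multiplicityAtZero μ₀) *
        ∏ x ∈ E, (Polynomial.X - Polynomial.C x) ^ 2 := by
  rw [testPolynomial, hE, finprod_mem_coe_finset]

end SecondChaos

end

theorem mainTheorem2
    {Ω : Type*} [MeasurableSpace Ω] (P : Measure Ω) [IsProbabilityMeasure P]
    (W : ℝ≥0 → Ω → ℝ) (hW : IsBrownianReal W P)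
    {Ω' : Type*} [MeasurableSpace Ω'] (P' : Measure Ω') [IsProbabilityMeasure P']
    (W' : ℝ≥0 → Ω' → ℝ) (hW' : IsBrownianReal W' P')
    (f : SecondChaos.L2Quadrant) (hf : SecondChaos.IsSymmetricKernel f)
    (hrank : SecondChaos.HasFiniteRank f)
    (μ₀ : ℝ) (hpos : 0 < |μ₀| + ‖f‖)
    (N : Ω' → ℝ) (hN : HasLaw N (gaussianReal 0 (μ₀ ^ 2).toNNReal) P')
    (hindep : IndepFun N (fun ω t => W' t ω) P')
    (G : Ω' → ℝ) (hG : SecondChaos.IsDoubleIntegral W' P' f G)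
    (F : ℕ → Ω → ℝ)
    (hF : ∀ n, ∃ g : SecondChaos.L2Quadrant,
      SecondChaos.IsSymmetricKernel g ∧ SecondChaos.IsDoubleIntegral W P g (F n)) :
    -- the value of the second cumulant of the limit
    SecondChaos.cumulant 2 (N + G) P' = μ₀ ^ 2 + 2 * ‖f‖ ^ 2 ∧
    -- the criterion, for any choice of the `a(f)` consecutive values `s, …, s + a(f) - 1`
    (∀ s : ℕ, 2 * SecondChaos.multiplicityAtZero μ₀ ≤ s →
      (TendstoInDistribution F atTop (N + G) (fun _ => P) P' ↔
        (Tendsto (fun n => SecondChaos.cumulant 2 (F n) P) atTop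
            (𝓝 (SecondChaos.cumulant 2 (N + G) P')) ∧
          Tendsto (fun n => ∑ r ∈ Finset.Icc 3 (SecondChaos.testPolynomial μ₀ f).natDegree,
              SecondChaos.taylorCoeff (SecondChaos.testPolynomial μ₀ f) r
                * (SecondChaos.cumulant r (F n) P / (((r - 1).factorial : ℝ) * 2 ^ (r - 1))))
            atTop
            (𝓝 (∑ r ∈ Finset.Icc 3 (SecondChaos.testPolynomial μ₀ f).natDegree,
              SecondChaos.taylorCoeff (SecondChaos.testPolynomial μ₀ f) r
                * (SecondChaos.cumulant r G P' / (((r - 1).factorial : ℝ) * 2 ^ (r - 1))))) ∧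
          ∀ r ∈ Finset.Ico s (s + SecondChaos.numEigenvalues f),
            Tendsto (fun n => SecondChaos.cumulant r (F n) P) atTop
              (𝓝 (SecondChaos.cumulant r G P'))))) ∧
    -- the fourth moment criterion
    (μ₀ ≠ 0 → f = 0 →
      (TendstoInDistribution F atTop N (fun _ => P) P' ↔
        (Tendsto (fun n => SecondChaos.cumulant 2 (F n) P) atTop (𝓝 (μ₀ ^ 2)) ∧
          Tendsto (fun n => SecondChaos.cumulant 4 (F n) P) atTop (𝓝 0)))) ∧
    -- the chi-square criterion
    (μ₀ = 0 → SecondChaos.nonzeroEigenvalues f = {1} →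
      (TendstoInDistribution F atTop G (fun _ => P) P' ↔
        (Tendsto (fun n => SecondChaos.cumulant 2 (F n) P) atTop
            (𝓝 (2 * (SecondChaos.rank f : ℝ))) ∧
          Tendsto (fun n => SecondChaos.cumulant 4 (F n) P
              - 12 * SecondChaos.cumulant 3 (F n) P) atTop
            (𝓝 (-48 * (SecondChaos.rank f : ℝ)))))) := by
  classical
  have hPW := hW.toIsPreBrownianReal
  have hPW' := hW'.toIsPreBrownianReal
  have hFm : ∀ n, AEMeasurable (F n) P := fun n => by
    obtain ⟨g, -, hg⟩ := hF n
    exact hg.1.aestronglyMeasurable.aemeasurable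
  have hFc : ∀ n, SecondChaos.IsChaosLimit (P.map (F n)) := fun n => by
    obtain ⟨g, -, hg⟩ := hF n
    exact hg.isChaosLimit hPW
  have hGm : AEMeasurable G P' := hG.1.aestronglyMeasurable.aemeasurable
  have hNm : AEMeasurable N P' := hN.aemeasurable
  obtain ⟨L, e, he, hten, hL0, hev⟩ := SecondChaos.exists_eigenvalues hf hrank
  set v : ℝ := μ₀ ^ 2 / 2 with hv
  have hv0 : 0 ≤ v := by positivity
  have hnorm : ‖f‖ ^ 2 = SecondChaos.powerSum L 2 := by
    obtain ⟨-, g, hg, -⟩ := hG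
    exact SecondChaos.sq_norm_eq_powerSum he hten hg
  -- the characteristic functions of the possible limits
  have hcharG : ∀ t : ℝ, charFun (P'.map G) t = Complex.exp
      (∑ j, SecondChaos.squareCgf (t * Complex.I * L j) - t ^ 2 * (0 : ℝ)) := by
    intro t
    obtain ⟨-, g, hg, hgG⟩ := hG
    have h1 := SecondChaos.tendsto_charFun_of_tendsto_eLpNorm
      (fun n => (g n).aemeasurable_integral hPW') hGm hgG t
    simp_rw [SecondChaos.StepKernel.map_integral _ hPW'] at h1
    refine tendsto_nhds_unique h1 (SecondChaos.tendsto_charFun_chaosLaw (v := 0) (fun r hr => ?_) t)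
    simpa using SecondChaos.tendsto_powerSum_eigenvalues he hten hg hr
  have hcharN : ∀ t : ℝ, charFun (P'.map N) t = Complex.exp (-(t ^ 2 * v)) := by
    intro t
    rw [hN.map_eq, charFun_gaussianReal, hv]
    congr 1
    have : (((μ₀ ^ 2).toNNReal : ℝ) : ℂ) = (μ₀ : ℂ) ^ 2 := by
      rw [Real.coe_toNNReal _ (sq_nonneg _)]; push_cast; rfl
    rw [this]
    push_cast
    ring
  have hcharNG : ∀ t : ℝ, charFun (P'.map (N + G)) t = Complex.exp
      (∑ j, SecondChaos.squareCgf (t * Complex.I * L j) - t ^ 2 * v) := by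
    intro t
    rw [hG.charFun_map_add hPW' hNm hindep, hcharN, hcharG, ← Complex.exp_add]
    congr 1
    push_cast
    ring
  have hprobG : IsProbabilityMeasure (P'.map G) := Measure.isProbabilityMeasure_map hGm
  have hprobNG : IsProbabilityMeasure (P'.map (N + G)) :=
    Measure.isProbabilityMeasure_map (hNm.add hGm)
  have hκG : ∀ r, 2 ≤ r → SecondChaos.cumulant r G P' =
      2 ^ (r - 1) * (r - 1).factorial * SecondChaos.powerSum L r := by
    intro r hr
    rw [SecondChaos.cumulant_eq_iteratedDeriv_cgf_map hGm,
      SecondChaos.cumulant_of_charFun_eq le_rfl hcharG hr]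
    simp
  have hκ2 : SecondChaos.cumulant 2 (N + G) P' = 2 * (SecondChaos.powerSum L 2 + v) := by
    rw [SecondChaos.cumulant_eq_iteratedDeriv_cgf_map (hNm.add hGm),
      SecondChaos.cumulant_of_charFun_eq hv0 hcharNG le_rfl]
    norm_num
  set E : Finset ℝ := Finset.univ.image L with hEdef
  have hE : ∀ x, x ∈ E ↔ ∃ j, L j = x := by simp [hEdef]
  have hEset : SecondChaos.nonzeroEigenvalues f = E := by
    ext x; rw [hev, Finset.mem_coe, hE]
  have h0E : (0 : ℝ) ∉ E := by simpa [hE] using hL0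
  set d : ℕ := if μ₀ ≠ 0 then 1 else 0 with hd
  have hmult : SecondChaos.multiplicityAtZero μ₀ = 1 + d := by
    rw [SecondChaos.multiplicityAtZero, hd]
  have hdv : d = 0 ∧ v = 0 ∨ d = 1 := by
    by_cases h : μ₀ = 0
    · left; simp [hd, hv, h]
    · right; simp [hd, h]
  have hQ : SecondChaos.testPolynomial μ₀ f = Polynomial.X ^ (2 * (1 + d)) *
      ∏ x ∈ E, (Polynomial.X - Polynomial.C x) ^ 2 := by
    rw [SecondChaos.testPolynomial_eq hEset, hmult]
  have hcard : SecondChaos.numEigenvalues f = E.card := by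
    rw [SecondChaos.numEigenvalues, hEset, Set.ncard_coe_finset]
  refine ⟨?_, fun s hs => ?_, fun hμ hf0 => ?_, fun hμ hone => ?_⟩
  · rw [hκ2, hnorm, hv]; ring
  · rw [hmult] at hs
    rw [SecondChaos.tendstoInDistribution_iff_of_charFun_eq hFm hFc (hNm.add hGm) hv0 hcharNG hE h0E
      hdv hs hQ, hκ2, hcard]
    have h1 : ∑ r ∈ Finset.Icc 3 (SecondChaos.testPolynomial μ₀ f).natDegree,
        SecondChaos.taylorCoeff (SecondChaos.testPolynomial μ₀ f) r
          * (SecondChaos.cumulant r G P' / (((r - 1).factorial : ℝ) * 2 ^ (r - 1))) =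
        ∑ r ∈ Finset.Icc 3 (SecondChaos.testPolynomial μ₀ f).natDegree,
          (SecondChaos.testPolynomial μ₀ f).coeff r * SecondChaos.powerSum L r := by
      refine Finset.sum_congr rfl fun r hr => ?_
      rw [SecondChaos.taylorCoeff_eq_coeff, hκG r (by rw [Finset.mem_Icc] at hr; omega)]
      field_simp
    rw [h1]
    simp_rw [SecondChaos.taylorCoeff_eq_coeff]
    refine and_congr_right fun _ => and_congr_right fun _ => forall₂_congr fun r hr => ?_
    rw [hκG r (by rw [Finset.mem_Ico] at hr; omega)]
  · -- all weights are nonzero, so `f = 0` has none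
    have hemp : IsEmpty (Fin (SecondChaos.rank f)) := by
      refine ⟨fun j => hL0 j ?_⟩
      have h1 : SecondChaos.powerSum L 2 = 0 := by rw [← hnorm, hf0]; simp
      have h2 := SecondChaos.abs_le_of_powerSum_two_le le_rfl (by rw [h1]; norm_num) j
      exact abs_nonpos_iff.1 h2
    have hps : ∀ r, SecondChaos.powerSum L r = 0 := fun r => by
      rw [SecondChaos.powerSum, Finset.univ_eq_empty, Finset.sum_empty]
    have hcharN' : ∀ t : ℝ, charFun (P'.map N) t = Complex.exp
        (∑ j, SecondChaos.squareCgf (t * Complex.I * L j) - t ^ 2 * v) := by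
      intro t
      rw [hcharN, Finset.univ_eq_empty, Finset.sum_empty, zero_sub]
    have hE0 : E = ∅ := by rw [hEdef, Finset.univ_eq_empty, Finset.image_empty]
    have hd1 : d = 1 := by simp [hd, hμ]
    rw [SecondChaos.tendstoInDistribution_iff_of_charFun_eq hFm hFc hNm hv0 hcharN' hE h0E hdv
      (s := 4) (by omega) rfl, hE0, hd1, hps]
    have hQ4 : (Polynomial.X ^ (2 * (1 + 1)) *
        ∏ x ∈ (∅ : Finset ℝ), (Polynomial.X - Polynomial.C x) ^ 2 : Polynomial ℝ) =
        Polynomial.X ^ 4 := by simp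
    have hIcc : Finset.Icc 3 4 = {3, 4} := by decide
    have hv2 : 2 * (0 + v) = μ₀ ^ 2 := by rw [hv]; ring
    rw [hQ4, Polynomial.natDegree_X_pow, hIcc, hv2]
    simp only [Finset.card_empty, add_zero, Finset.Ico_self, Finset.notMem_empty, IsEmpty.forall_iff,
      implies_true, and_true, Finset.sum_pair (show (3 : ℕ) ≠ 4 by norm_num), hps,
      Polynomial.coeff_X_pow, if_true, if_neg (show (3 : ℕ) ≠ 4 by norm_num), zero_mul, mul_zero,
      zero_add, one_mul]
    refine and_congr_right fun _ => ⟨fun h => ?_, fun h => ?_⟩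
    · have h1 := h.mul_const (((4 - 1).factorial : ℝ) * 2 ^ (4 - 1))
      rw [zero_mul] at h1
      exact h1.congr fun n => div_mul_cancel₀ _ (by positivity)
    · simpa using h.div_const (((4 - 1).factorial : ℝ) * 2 ^ (4 - 1))
  · have hL1 : ∀ j, L j = 1 := fun j => by
      have : L j ∈ SecondChaos.nonzeroEigenvalues f := (hev _).2 ⟨j, rfl⟩
      rw [hone] at this
      exact this
    have hps : ∀ r, SecondChaos.powerSum L r = SecondChaos.rank f := fun r => by
      simp [SecondChaos.powerSum, hL1]
    have hE1 : E = {1} := by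
      rw [← Finset.coe_inj, ← hEset, hone, Finset.coe_singleton]
    have hd0 : d = 0 := by simp [hd, hμ]
    rw [SecondChaos.tendstoInDistribution_iff_of_charFun_eq hFm hFc hGm le_rfl hcharG hE h0E
      (.inl ⟨hd0, rfl⟩) (s := 2) (by omega) rfl, hE1, hd0]
    have hQ4 : (Polynomial.X ^ (2 * (1 + 0)) *
        ∏ x ∈ ({1} : Finset ℝ), (Polynomial.X - Polynomial.C x) ^ 2 : Polynomial ℝ) =
        Polynomial.X ^ 4 - Polynomial.C 2 * Polynomial.X ^ 3 + Polynomial.X ^ 2 := by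
      rw [Finset.prod_singleton, map_one, map_ofNat]; ring
    have hdeg : (Polynomial.X ^ 4 - Polynomial.C 2 * Polynomial.X ^ 3 + Polynomial.X ^ 2 :
        Polynomial ℝ).natDegree = 4 := by compute_degree!
    have hc3 : (Polynomial.X ^ 4 - Polynomial.C 2 * Polynomial.X ^ 3 + Polynomial.X ^ 2 :
        Polynomial ℝ).coeff 3 = -2 := by simp [Polynomial.coeff_X_pow]
    have hc4 : (Polynomial.X ^ 4 - Polynomial.C 2 * Polynomial.X ^ 3 + Polynomial.X ^ 2 :
        Polynomial ℝ).coeff 4 = 1 := by simp [Polynomial.coeff_X_pow]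
    have hIcc : Finset.Icc 3 4 = {3, 4} := by decide
    have hIco : Finset.Ico 2 (2 + ({1} : Finset ℝ).card) = {2} := by
      rw [Finset.card_singleton]; decide
    rw [hQ4, hdeg, hIcc, hIco]
    simp only [Finset.sum_pair (show (3 : ℕ) ≠ 4 by norm_num), hps, hc3, hc4, Finset.mem_singleton,
      forall_eq, add_zero]
    have hval : ∀ n, -2 * (SecondChaos.cumulant 3 (F n) P / (((3 - 1).factorial : ℝ) * 2 ^ (3 - 1)))
        + 1 * (SecondChaos.cumulant 4 (F n) P / (((4 - 1).factorial : ℝ) * 2 ^ (4 - 1))) =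
        (SecondChaos.cumulant 4 (F n) P - 12 * SecondChaos.cumulant 3 (F n) P) / 48 := by
      intro n
      norm_num [Nat.factorial]
      ring
    simp_rw [hval]
    constructor
    · rintro ⟨h1, h2, -⟩
      refine ⟨h1, ?_⟩
      convert h2.mul_const 48 using 2 <;> ring
    · rintro ⟨h1, h2⟩
      refine ⟨h1, ?_, by simpa using h1⟩
      convert h2.div_const 48 using 2
      ring
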